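/- \textbf{Setting.} A one-airport landing market consists of a finite set $A$ of flights, a finite set $B$ of time-slots, a capacity $c(s)\in\mathbb Z_{\ge 0}$ for each slot $s\in B$, and for each flight $i\in A$ a criticality factor $\alpha_i$, a landing window $W(i)\subseteq B$ and delays $d_i(s)$ for $s\in W(i)$, where the $\alpha_i$ and $d_i(s)$ are arbitrary elements of an ordered field (such as $\mathbb R$ or $\mathbb Q$). A landing schedule assigns to each flight $i$ a slot $a(i)\in W(i)$ so that every slot $s$ receives at most $c(s)$ flights. Given prices $p_s$, the total cost of flight $i$ in slot $s$ is $p_s+\alpha_i d_i(s)$. A landing schedule $a$ and prices $p_s\ge 0$ are an equilibrium if every flight $i$ incurs a minimum total cost, i.e. $p_{a(i)}+\alpha_i d_i(a(i))\le p_s+\alpha_i d_i(s)$ for all $s\in W(i)$, and $p_s=0$ for every slot $s$ that receives fewer than $c(s)$ flights. \textbf{Theorem.} (1) There is a combinatorial, strongly polynomial algorithm that, for every such market, computes an equilibrium landing schedule and prices, or reports correctly that there is no landing schedule. Here \emph{combinatorial} means that the only operations performed on the numbers of the instance are additions, subtractions and comparisons, apart from forming products of two input numbers (such as the delay costs $\alpha_i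 d_i(s)$). \emph{Strongly polynomial} means that one program on a random access machine, the same for all instances, performs a number of elementary operations bounded by a polynomial in $|A|+|B|$ (independently of the numbers $\alpha_i,d_i(s),c(s)$), and that on rational data the number of bit operations (each elementary operation being charged the bit lengths of the numbers involved) is bounded by a polynomial in the bit length of the instance. (2) Let $G$ be the bipartite graph with classes $A\cup\{v\}$ and $B$, where $v$ is a dummy vertex, with an edge $(i,s)$ of weight $\alpha_i d_i(s)$ for each $i\in A$, $s\in W(i)$ and an edge $(v,s)$ of weight $1$ for each $s\in B$, and let $b(i)=1$ for $i\in A$, $b(s)=c(s)$ for $s\in B$, $b(v)=\sum_{s\in B}c(s)-|A|$. A perfect $b$-matching is a function $x$ from the edges to $\mathbb Z_{\ge 0}$ whose values on the edges at each vertex $u$ sum to $b(u)$. Optimal vertex duals are numbers $y_u$, one for each vertex, that maximize $\sum_u b(u)y_u$ subject to $y_u+y_s\le w(u,s)$ for every edge $(u,s)$ of weight $w(u,s)$. Then $G$ has a perfect $b$-matching if and only if the market has a landing schedule, and in this case a minimum-weight perfect $b$-matching and optimal vertex duals exist. For every minimum-weight perfect $b$-matching $x$ and all optimal vertex duals $y$,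 the schedule that assigns to each flight $i$ the unique slot $a(i)$ with $x(i,a(i))=1$, together with the prices $p_s=1-y_v-y_s$, is an equilibrium, and the total cost incurred by flight $i$ in it is $t_i=y_i+1-y_v$. (For duals normalized so that $y_v=1$ these are $p_s=-y_s$ and $t_i=y_i$.) -/

import Mathlib

namespace ATFM

/-! ### The one-airport landing market -/

/-- A landing market with flights `A`, time-slots `B` and numerical data in `K`.
`delay i s` is only used for `s ∈ window i`. -/
structure Market (K A B : Type) where
  /-- criticality factor -/
  crit : A → K
  /-- landing window -/
  window : A → Finset B
  /-- delay of a flight if it lands in a slot -/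
  delay : A → B → K
  /-- capacity of a slot -/
  cap : B → ℕ

namespace Market

variable {K A B : Type}

/-- An assignment of the flights to slots of their windows that respects the capacities. -/
def IsLandingSchedule [Fintype A] [DecidableEq B] (M : Market K A B) (a : A → B) : Prop :=
  (∀ i, a i ∈ M.window i) ∧ ∀ s, (Finset.univ.filter fun i => a i = s).card ≤ M.cap s

/-- Landing price plus cost of the delay. -/
def totalCost [Field K] (M : Market K A B) (p : B → K) (i : A) (s : B) : K :=
  p s + M.crit i * M.delay i s

/-- Equilibrium landing schedule and (non-negative) prices. -/
structure IsEquilibrium [Field K] [LinearOrder K] [Fintype A] [DecidableEq B]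
    (M : Market K A B) (a : A → B) (p : B → K) : Prop where
  schedule : M.IsLandingSchedule a
  price_nonneg : ∀ s, 0 ≤ p s
  /-- every flight incurs a minimum total cost over its window -/
  min_cost : ∀ i, ∀ s ∈ M.window i, M.totalCost p i (a i) ≤ M.totalCost p i s
  /-- a slot that is not filled to capacity is free -/
  unfilled_free : ∀ s, (Finset.univ.filter fun i => a i = s).card < M.cap s → p s = 0

end Market

/-! ### Minimum-weight perfect `b`-matchings in bipartite graphs -/

/-- An edge-weighted bipartite graph with vertex classes `U`, `V`. The weight of a pair that
is not an edge is never used. -/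
structure WBipartite (K U V : Type) where
  edge : U → V → Prop
  weight : U → V → K

namespace WBipartite

variable {K U V : Type} [Field K] [LinearOrder K] [Fintype U] [Fintype V]

/-- `x` gives the multiplicities of the edges in a perfect `b`-matching. -/
structure IsPerfectBMatching (G : WBipartite K U V) (bU : U → ℤ) (bV : V → ℤ)
    (x : U → V → ℕ) : Prop where
  supp : ∀ u v, ¬ G.edge u v → x u v = 0
  left : ∀ u, ∑ v, (x u v : ℤ) = bU u
  right : ∀ v, ∑ u, (x u v : ℤ) = bV v

/-- Total weight of a matching (`x` vanishes off the edges). -/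
def totalWeight (G : WBipartite K U V) (x : U → V → ℕ) : K :=
  ∑ u, ∑ v, (x u v : K) * G.weight u v

def IsMinPerfectBMatching (G : WBipartite K U V) (bU : U → ℤ) (bV : V → ℤ)
    (x : U → V → ℕ) : Prop :=
  G.IsPerfectBMatching bU bV x ∧
    ∀ x', G.IsPerfectBMatching bU bV x' → G.totalWeight x ≤ G.totalWeight x'

/-- Feasible vertex duals. -/
def IsDualFeasible (G : WBipartite K U V) (yU : U → K) (yV : V → K) : Prop :=
  ∀ u v, G.edge u v → yU u + yV v ≤ G.weight u v

def dualValue (bU : U → ℤ) (bV : V → ℤ) (yU : U → K) (yV : V → K) : K :=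
  ∑ u, (bU u : K) * yU u + ∑ v, (bV v : K) * yV v

/-- Optimal vertex duals. -/
def IsOptimalDual (G : WBipartite K U V) (bU : U → ℤ) (bV : V → ℤ)
    (yU : U → K) (yV : V → K) : Prop :=
  G.IsDualFeasible yU yV ∧
    ∀ zU zV, G.IsDualFeasible zU zV → dualValue bU bV zU zV ≤ dualValue bU bV yU yV

end WBipartite

namespace Market

variable {K A B : Type}

/-- The bipartite graph of the market: flights and a dummy vertex `none` on one side, slots on
the other; the dummy vertex is joined to every slot by an edge of unit weight. -/
def graph [Field K] (M : Market K A B) : WBipartite K (Option A) B where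
  edge u s := match u with
    | none => True
    | some i => s ∈ M.window i
  weight u s := match u with
    | none => 1
    | some i => M.crit i * M.delay i s

/-- Requirements on the side of the flights: `1` for each flight and the total capacity minus
the number of flights for the dummy vertex. -/
def leftReq [Fintype A] [Fintype B] (M : Market K A B) : Option A → ℤ
  | none => ∑ s, (M.cap s : ℤ) - Fintype.card A
  | some _ => 1

/-- Requirements on the side of the slots. -/
def rightReq (M : Market K A B) : B → ℤ := fun s => M.cap s

end Market

/-! ### Combinatorial algorithms

A structured random access machine with two working memories, both organised in
two-dimensional arrays: an index memory for natural numbers, and a number memory for elements of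
an ordered field. The numbers of the input are kept in a separate read-only memory. On the
number memory only additions, subtractions and comparisons are available; the only products
that can be formed are products of two input numbers. There is no division, and no
multiplication of indices. -/

/-- Index expressions; `get a i j` reads the entry `(i, j)` of the array `a`. -/
inductive IExpr where
  | const (k : ℕ)
  | get (a : ℕ) (i j : IExpr)
  | add (e f : IExpr)
  | sub (e f : IExpr)

/-- Number expressions. `inp` reads the input, `prod` multiplies two entries of the input. -/
inductive NExpr where
  | const (k : ℕ)
  | inp (a : ℕ) (i j : IExpr)
  | prod (a : ℕ) (i j : IExpr) (b : ℕ) (k l : IExpr)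
  | get (a : ℕ) (i j : IExpr)
  | add (e f : NExpr)
  | sub (e f : NExpr)

/-- Tests. -/
inductive Test where
  | ilt (e f : IExpr)
  | nlt (e f : NExpr)
  | neg (c : Test)
  | and (c d : Test)

/-- Programs: assignments to array entries, sequencing, branching and loops. -/
inductive Prog where
  | skip
  | iset (a : ℕ) (i j : IExpr) (e : IExpr)
  | nset (a : ℕ) (i j : IExpr) (e : NExpr)
  | seq (p q : Prog)
  | ite (c : Test) (p q : Prog)
  | loop (c : Test) (p : Prog)

/-- The working memory: array name, row, column. -/
structure Store (K : Type) where
  idx : ℕ → ℕ → ℕ → ℕ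
  num : ℕ → ℕ → ℕ → K

/-- What it costs to handle an index or a number. -/
structure CostModel (K : Type) where
  idx : ℕ → ℕ
  num : K → ℕ

/-- Every elementary operation costs one unit. -/
def unitCost (K : Type) : CostModel K where
  idx _ := 1
  num _ := 1

/-- Number of bits of a rational number, written as a reduced fraction with a sign. -/
def bitSize (x : ℚ) : ℕ := x.num.natAbs.size + x.den.size + 1

/-- Every elementary operation costs the number of bits that are handled. -/
def bitCost : CostModel ℚ where
  idx k := k.size + 1
  num := bitSize

section Semantics

variable {K : Type}

/-- Truncated subtraction on indices. -/
def IExpr.eval (σ : Store K) : IExpr → ℕ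
  | .const k => k
  | .get a i j => σ.idx a (i.eval σ) (j.eval σ)
  | .add e f => e.eval σ + f.eval σ
  | .sub e f => e.eval σ - f.eval σ

def IExpr.cost (w : CostModel K) (σ : Store K) : IExpr → ℕ
  | .const k => w.idx k
  | .get a i j => i.cost w σ + j.cost w σ + w.idx ((IExpr.get a i j).eval σ)
  | .add e f => e.cost w σ + f.cost w σ + w.idx ((IExpr.add e f).eval σ)
  | .sub e f => e.cost w σ + f.cost w σ + w.idx ((IExpr.sub e f).eval σ)

variable [Field K]

def NExpr.eval (inp : ℕ → ℕ → ℕ → K) (σ : Store K) : NExpr → K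
  | .const k => (k : K)
  | .inp a i j => inp a (i.eval σ) (j.eval σ)
  | .prod a i j b k l =>
      inp a (i.eval σ) (j.eval σ) * inp b (k.eval σ) (l.eval σ)
  | .get a i j => σ.num a (i.eval σ) (j.eval σ)
  | .add e f => e.eval inp σ + f.eval inp σ
  | .sub e f => e.eval inp σ - f.eval inp σ

def NExpr.cost (w : CostModel K) (inp : ℕ → ℕ → ℕ → K) (σ : Store K) : NExpr → ℕ
  | .const k => w.num (k : K)
  | .inp a i j => i.cost w σ + j.cost w σ + w.num (inp a (i.eval σ) (j.eval σ))
  | .prod a i j b k l =>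
      i.cost w σ + j.cost w σ + w.num (inp a (i.eval σ) (j.eval σ)) +
      (k.cost w σ + l.cost w σ + w.num (inp b (k.eval σ) (l.eval σ))) +
      w.num (inp a (i.eval σ) (j.eval σ) * inp b (k.eval σ) (l.eval σ))
  | .get a i j => i.cost w σ + j.cost w σ + w.num (σ.num a (i.eval σ) (j.eval σ))
  | .add e f => e.cost w inp σ + f.cost w inp σ + w.num (e.eval inp σ + f.eval inp σ)
  | .sub e f => e.cost w inp σ + f.cost w inp σ + w.num (e.eval inp σ - f.eval inp σ)

def Test.Holds [LinearOrder K] (inp : ℕ → ℕ → ℕ → K) (σ : Store K) : Test → Prop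
  | .ilt e f => e.eval σ < f.eval σ
  | .nlt e f => e.eval inp σ < f.eval inp σ
  | .neg c => ¬ c.Holds inp σ
  | .and c d => c.Holds inp σ ∧ d.Holds inp σ

def Test.cost (w : CostModel K) (inp : ℕ → ℕ → ℕ → K) (σ : Store K) : Test → ℕ
  | .ilt e f => e.cost w σ + f.cost w σ + 1
  | .nlt e f => e.cost w inp σ + f.cost w inp σ + 1
  | .neg c => c.cost w inp σ + 1
  | .and c d => c.cost w inp σ + d.cost w inp σ + 1

/-- Overwrite one entry of the index memory. -/
def Store.setIdx (σ : Store K) (a i j v : ℕ) : Store K where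
  idx a' i' j' := if a' = a ∧ i' = i ∧ j' = j then v else σ.idx a' i' j'
  num := σ.num

/-- Overwrite one entry of the number memory. -/
def Store.setNum (σ : Store K) (a i j : ℕ) (v : K) : Store K where
  idx := σ.idx
  num a' i' j' := if a' = a ∧ i' = i ∧ j' = j then v else σ.num a' i' j'

/-- `Exec w inp P σ t τ`: on the input `inp`, the program `P` started in the store `σ` halts in
the store `τ`, at total cost `t` in the cost model `w`. -/
inductive Exec [LinearOrder K] (w : CostModel K) (inp : ℕ → ℕ → ℕ → K) :
    Prog → Store K → ℕ → Store K → Prop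
  | skip (σ : Store K) : Exec w inp .skip σ 1 σ
  | iset (σ : Store K) (a : ℕ) (i j e : IExpr) :
      Exec w inp (.iset a i j e) σ (i.cost w σ + j.cost w σ + e.cost w σ + 1)
        (σ.setIdx a (i.eval σ) (j.eval σ) (e.eval σ))
  | nset (σ : Store K) (a : ℕ) (i j : IExpr) (e : NExpr) :
      Exec w inp (.nset a i j e) σ (i.cost w σ + j.cost w σ + e.cost w inp σ + 1)
        (σ.setNum a (i.eval σ) (j.eval σ) (e.eval inp σ))
  | seq {p q : Prog} {σ τ ρ : Store K} {t t' : ℕ} :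
      Exec w inp p σ t τ → Exec w inp q τ t' ρ → Exec w inp (.seq p q) σ (t + t') ρ
  | ite_true {c : Test} {p q : Prog} {σ τ : Store K} {t : ℕ} :
      c.Holds inp σ → Exec w inp p σ t τ →
        Exec w inp (.ite c p q) σ (c.cost w inp σ + 1 + t) τ
  | ite_false {c : Test} {p q : Prog} {σ τ : Store K} {t : ℕ} :
      ¬ c.Holds inp σ → Exec w inp q σ t τ →
        Exec w inp (.ite c p q) σ (c.cost w inp σ + 1 + t) τ
  | loop_true {c : Test} {p : Prog} {σ τ ρ : Store K} {t t' : ℕ} :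
      c.Holds inp σ → Exec w inp p σ t τ → Exec w inp (.loop c p) τ t' ρ →
        Exec w inp (.loop c p) σ (c.cost w inp σ + 1 + t + t') ρ
  | loop_false {c : Test} {p : Prog} {σ : Store K} :
      ¬ c.Holds inp σ → Exec w inp (.loop c p) σ (c.cost w inp σ + 1) σ

end Semantics

/-! ### Input and output of an algorithm for the market -/

namespace Market

variable {K : Type} [Field K] {n m : ℕ}

/-- The numbers of the input: array `0` holds the criticality factors, array `1` the delays
within the landing windows, array `2` the capacities. -/
def inputNum (M : Market K (Fin n) (Fin m)) (a i j : ℕ) : K :=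
  if a = 0 then
    if h : i < n ∧ j = 0 then M.crit ⟨i, h.1⟩ else 0
  else if a = 1 then
    if h : i < n ∧ j < m then
      if (⟨j, h.2⟩ : Fin m) ∈ M.window ⟨i, h.1⟩ then M.delay ⟨i, h.1⟩ ⟨j, h.2⟩ else 0
    else 0
  else if a = 2 then
    if h : i < m ∧ j = 0 then (M.cap ⟨i, h.1⟩ : K) else 0
  else 0

/-- The initial store: index array `0` holds the numbers of flights and of slots, index array
`1` the incidence matrix of the landing windows, everything else is `0`. -/
def initStore (M : Market K (Fin n) (Fin m)) : Store K where
  idx a i j :=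
    if a = 0 then
      if i = 0 ∧ j = 0 then n else if i = 0 ∧ j = 1 then m else 0
    else if a = 1 then
      if h : i < n ∧ j < m then
        if (⟨j, h.2⟩ : Fin m) ∈ M.window ⟨i, h.1⟩ then 1 else 0
      else 0
    else 0
  num _ _ _ := 0

/-- The final store is a correct answer: either the flag (index array `2`) is `1`, index array
`3` holds a landing schedule and number array `0` holds prices which are an equilibrium
together; or the flag is `0` and there is no landing schedule at all. -/
def IsCorrectOutput [LinearOrder K] (M : Market K (Fin n) (Fin m)) (τ : Store K) : Prop :=
  (τ.idx 2 0 0 = 1 ∧ ∃ a : Fin n → Fin m,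
      (∀ i : Fin n, τ.idx 3 i 0 = a i) ∧ M.IsEquilibrium a fun s : Fin m => τ.num 0 s 0) ∨
    (τ.idx 2 0 0 = 0 ∧ ¬ ∃ a, M.IsLandingSchedule a)

/-- Number of bits of an instance with rational data. -/
def bitLength (M : Market ℚ (Fin n) (Fin m)) : ℕ :=
  n + m + n * m + ∑ i, bitSize (M.crit i) +
    ∑ i, ∑ s ∈ M.window i, bitSize (M.delay i s) + ∑ s, (M.cap s).size

end Market

/-- The program `P` is a strongly polynomial algorithm for equilibrium schedules and prices:
over every ordered field it gives a correct answer, with a number of elementary operations that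
is polynomially bounded in the numbers of flights and of slots; and on rational data its
running time, measured in bit operations, is polynomially bounded in the bit length. -/
structure IsStronglyPolynomialMarketAlgorithm (P : Prog) : Prop where
  arithmetic : ∃ q : Polynomial ℕ, ∀ (K : Type) [Field K] [LinearOrder K]
    [IsStrictOrderedRing K] (n m : ℕ) (M : Market K (Fin n) (Fin m)),
    ∃ (t : ℕ) (τ : Store K), Exec (unitCost K) M.inputNum P M.initStore t τ ∧
      t ≤ q.eval (n + m) ∧ M.IsCorrectOutput τ
  bit : ∃ q : Polynomial ℕ, ∀ (n m : ℕ) (M : Market ℚ (Fin n) (Fin m)),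
    ∃ (t : ℕ) (τ : Store ℚ), Exec bitCost M.inputNum P M.initStore t τ ∧
      t ≤ q.eval M.bitLength ∧ M.IsCorrectOutput τ

end ATFM

open ATFM

namespace ATFM

/-! ### From unit cost to bit cost -/

section BitTransfer

/-! An equilibrium is a primal-dual pair without duality gap. Give the dummy vertex the dual `1`,
slot `s` the dual `-p s`, and each flight its total cost. Feasibility on the edges at flights is
then cost minimality, and on the dummy edges it is nonnegativity of prices. The gap between weight
and dual value is the sum of multiplicity times slack over all edges
(`WBipartite.totalWeight_sub_dualValue`). If it vanishes, every flight pays exactly its dual, and a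
slot with spare capacity, where the dummy edge is used, is free. One gap-free pair therefore forces
complementary slackness for every optimal pair. Such a pair comes from the algorithm itself, not
from linear programming duality: its correctness (`marketProg_correct`) is also the existence proof
(`Market.exists_equilibrium`, `Market.exists_tight_pair`).

The algorithm is the Hungarian method. Unassigned flights sit in a virtual slot, the root of a
search tree of filled slots joined by tight edges. In each round the costs of the flights and the
prices of the slots in the tree rise by the least slack `δ` of an edge leaving the tree, so that a
new slot is reached (`PDInv.grow`). If this slot has room, the flights on the path to the root are
shifted by one slot and one more flight is assigned (`FlipInv.step`, `FlipInv.finish`). Only filled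
slots get dearer, so unfilled ones stay free. If no edge leaves the tree, its flights outnumber the
places in all slots open to them, which refutes feasibility (`PDInv.infeasible`). There are at most
`(n + 1) * (m + 1)` rounds; a program logic with a syntactic time bound (`Runs`) turns this into a
polynomial number of operations.

For bit complexity, all numbers are written over one common denominator. Since computed numbers are
only added and subtracted, numerators gain at most one bit per operation, so the unit-cost bound
implies the bit bound (`Exec.bit_of_unit`). -/

def IExpr.constSum : IExpr → ℕ
  | .const k => k
  | .get _ i j => i.constSum + j.constSum
  | .add e f => e.constSum + f.constSum
  | .sub e f => e.constSum + f.constSum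

def NExpr.constSum : NExpr → ℕ
  | .const k => k
  | .inp _ i j => i.constSum + j.constSum
  | .prod _ i j _ k l => i.constSum + j.constSum + (k.constSum + l.constSum)
  | .get _ i j => i.constSum + j.constSum
  | .add e f => e.constSum + f.constSum
  | .sub e f => e.constSum + f.constSum

def Test.constSum : Test → ℕ
  | .ilt e f => e.constSum + f.constSum
  | .nlt e f => e.constSum + f.constSum
  | .neg c => c.constSum
  | .and c d => c.constSum + d.constSum

/-- A bound for every literal in the program. Besides the initial store and the input, literals are
the only source of values, so their size must enter the bit bounds. -/
def Prog.constSum : Prog → ℕ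
  | .skip => 0
  | .iset _ i j e => i.constSum + j.constSum + e.constSum
  | .nset _ i j e => i.constSum + j.constSum + e.constSum
  | .seq p q => p.constSum + q.constSum
  | .ite c p q => c.constSum + p.constSum + q.constSum
  | .loop c p => c.constSum + p.constSum

/-- `x` is a fraction with denominator `D` and a numerator of at most `L` bits. -/
def FracBound (D L : ℕ) (x : ℚ) : Prop := ∃ z : ℤ, x * D = z ∧ |z| ≤ 2 ^ L

theorem FracBound.mono {D L L' : ℕ} {x : ℚ} (h : FracBound D L x) (hL : L ≤ L') :
    FracBound D L' x := by
  obtain ⟨z, hz, hb⟩ := h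
  exact ⟨z, hz, hb.trans (pow_le_pow_right₀ (by norm_num) hL)⟩

theorem FracBound.add {D L : ℕ} {x y : ℚ} (hx : FracBound D L x) (hy : FracBound D L y) :
    FracBound D (L + 1) (x + y) := by
  obtain ⟨z, hz, hb⟩ := hx
  obtain ⟨z', hz', hb'⟩ := hy
  refine ⟨z + z', by push_cast; rw [add_mul, hz, hz'], ?_⟩
  have := abs_add_le z z'
  rw [pow_succ]; linarith

theorem FracBound.sub {D L : ℕ} {x y : ℚ} (hx : FracBound D L x) (hy : FracBound D L y) :
    FracBound D (L + 1) (x - y) := by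
  obtain ⟨z, hz, hb⟩ := hx
  obtain ⟨z', hz', hb'⟩ := hy
  refine ⟨z - z', by push_cast; rw [sub_mul, hz, hz'], ?_⟩
  have := abs_sub z z'
  rw [pow_succ]; linarith

theorem size_le_of_le_two_pow {k L : ℕ} (h : k ≤ 2 ^ L) : k.size ≤ L + 1 := by
  rw [Nat.size_le, pow_succ]
  have : 0 < 2 ^ L := by positivity
  omega

/-- Reducing the fraction can only shrink it: the reduced denominator divides `D` and the reduced
numerator divides the given one. -/
theorem FracBound.bitSize_le {D L : ℕ} (hD : 0 < D) {x : ℚ} (h : FracBound D L x) :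
    bitSize x ≤ L + D.size + 2 := by
  obtain ⟨z, hz, hb⟩ := h
  have hx : x = Rat.divInt z D := by
    have : (D : ℚ) ≠ 0 := by positivity
    rw [Rat.divInt_eq_div]
    push_cast
    rw [eq_div_iff this, hz]
  have hden : (x.den : ℤ) ∣ D := by rw [hx]; exact Rat.den_dvd z D
  have hden' : x.den ≤ D := Nat.le_of_dvd hD (by exact_mod_cast hden)
  have hnum : x.num ∣ z := by
    rw [hx]; exact Rat.num_dvd z (Int.natCast_ne_zero.mpr hD.ne')
  have hnum' : x.num.natAbs ≤ 2 ^ L := by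
    have hz2 : z.natAbs ≤ 2 ^ L := by zify; simpa using hb
    rcases eq_or_ne z 0 with h0 | h0
    · have : x = 0 := by rw [hx, h0]; simp
      rw [this]; simp
    · exact (Nat.le_of_dvd (Int.natAbs_pos.mpr h0) (Int.natAbs_dvd_natAbs.mpr hnum)).trans hz2
  have h1 := size_le_of_le_two_pow hnum'
  have h2 := Nat.size_le_size hden'
  unfold bitSize
  omega

theorem le_two_pow_trans {a L L' : ℕ} (h : a ≤ 2 ^ L) (hL : L ≤ L') : a ≤ 2 ^ L' :=
  h.trans (pow_le_pow_right₀ (by norm_num) hL)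

/-- All entries of the working memory have at most about `L` bits. -/
structure StoreBound (D L : ℕ) (σ : Store ℚ) : Prop where
  idx : ∀ a i j, σ.idx a i j ≤ 2 ^ L
  num : ∀ a i j, FracBound D L (σ.num a i j)

theorem StoreBound.mono {D L L' : ℕ} {σ : Store ℚ} (h : StoreBound D L σ) (hL : L ≤ L') :
    StoreBound D L' σ :=
  ⟨fun a i j => (h.idx a i j).trans (pow_le_pow_right₀ (by norm_num) hL),
    fun a i j => (h.num a i j).mono hL⟩

/-- The numbers available at the start: inputs, their products and constants up to `N`. -/
structure InputBound (D L N : ℕ) (inp : ℕ → ℕ → ℕ → ℚ) : Prop where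
  pos : 0 < D
  const : ∀ k ≤ N, FracBound D L (k : ℚ)
  idx : N ≤ 2 ^ L
  input : ∀ a i j, FracBound D L (inp a i j)
  product : ∀ a i j b k l, FracBound D L (inp a i j * inp b k l)

variable {D L N B : ℕ} {inp : ℕ → ℕ → ℕ → ℚ} {σ : Store ℚ}

/-- An addition at most doubles the larger operand, and its node contributes one unit to the cost,
which pays for the extra bit. -/
theorem IExpr.eval_le (hσ : StoreBound D L σ) (hN : N ≤ 2 ^ L) (e : IExpr)
    (he : e.constSum ≤ N) : e.eval σ ≤ 2 ^ (L + e.cost (unitCost ℚ) σ) := by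
  induction e with
  | const k =>
    exact (he.trans hN).trans (pow_le_pow_right₀ (by norm_num) (by omega))
  | get a i j =>
    exact (hσ.idx _ _ _).trans (pow_le_pow_right₀ (by norm_num) (by omega))
  | add e f ihe ihf =>
    simp only [IExpr.constSum] at he
    have h1 := le_two_pow_trans (ihe (by omega))
      (show _ ≤ L + (e.cost (unitCost ℚ) σ + f.cost (unitCost ℚ) σ) by omega)
    have h2 := le_two_pow_trans (ihf (by omega))
      (show _ ≤ L + (e.cost (unitCost ℚ) σ + f.cost (unitCost ℚ) σ) by omega)
    simp only [IExpr.eval, IExpr.cost]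
    have h3 : (unitCost ℚ).idx ((IExpr.add e f).eval σ) = 1 := rfl
    simp only [IExpr.eval] at h3
    rw [h3, ← add_assoc, pow_succ]
    omega
  | sub e f ihe ihf =>
    simp only [IExpr.constSum] at he
    have h1 := le_two_pow_trans (ihe (by omega))
      (show _ ≤ L + (IExpr.sub e f).cost (unitCost ℚ) σ by simp only [IExpr.cost]; omega)
    simp only [IExpr.eval]
    omega

theorem NExpr.eval_bound (hσ : StoreBound D L σ) (hI : InputBound D L N inp)
    (e : NExpr) (he : e.constSum ≤ N) :
    FracBound D (L + e.cost (unitCost ℚ) inp σ) (e.eval inp σ) := by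
  induction e with
  | const k => exact (hI.const k he).mono (by omega)
  | inp a i j => exact (hI.input _ _ _).mono (by omega)
  | prod a i j b k l => exact (hI.product _ _ _ _ _ _).mono (by omega)
  | get a i j => exact (hσ.num _ _ _).mono (by omega)
  | add e f ihe ihf =>
    simp only [NExpr.constSum] at he
    exact FracBound.add
      ((ihe (by omega)).mono (Nat.add_le_add_left (Nat.le_add_right _ _) L))
      ((ihf (by omega)).mono (Nat.add_le_add_left (Nat.le_add_left _ _) L))
  | sub e f ihe ihf =>
    simp only [NExpr.constSum] at he
    exact FracBound.sub
      ((ihe (by omega)).mono (Nat.add_le_add_left (Nat.le_add_right _ _) L))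
      ((ihf (by omega)).mono (Nat.add_le_add_left (Nat.le_add_left _ _) L))

theorem bitCost_idx_le {v : ℕ} (h : v ≤ 2 ^ B) : bitCost.idx v ≤ B + 2 := by
  have := size_le_of_le_two_pow h
  simp only [bitCost]; omega

theorem IExpr.bit_cost_le (hσ : StoreBound D L σ) (hN : N ≤ 2 ^ L) (e : IExpr)
    (he : e.constSum ≤ N) (hB : L + e.cost (unitCost ℚ) σ ≤ B) :
    e.cost bitCost σ ≤ e.cost (unitCost ℚ) σ * (B + 2) := by
  have hv : bitCost.idx (e.eval σ) ≤ B + 2 := bitCost_idx_le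
    ((IExpr.eval_le hσ hN e he).trans (pow_le_pow_right₀ (by norm_num) hB))
  induction e with
  | const k => simpa [IExpr.cost, unitCost, IExpr.eval] using hv
  | get a e f ihe ihf | add e f ihe ihf | sub e f ihe ihf =>
    simp only [IExpr.constSum] at he
    simp only [IExpr.cost] at hB ⊢
    have h1 := ihe (by omega) (by omega) (bitCost_idx_le
      ((IExpr.eval_le hσ hN e (by omega)).trans (pow_le_pow_right₀ (by norm_num) (by omega))))
    have h2 := ihf (by omega) (by omega) (bitCost_idx_le
      ((IExpr.eval_le hσ hN f (by omega)).trans (pow_le_pow_right₀ (by norm_num) (by omega))))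
    have h3 : ∀ k, (unitCost ℚ).idx k = 1 := fun _ => rfl
    rw [h3, add_mul, add_mul, one_mul]
    omega

/-- Each elementary operation of unit cost handles one value, and all these values have at most `B +
D.size + 2` bits. -/
theorem NExpr.bit_cost_le (hσ : StoreBound D L σ) (hI : InputBound D L N inp) (e : NExpr)
    (he : e.constSum ≤ N) (hB : L + e.cost (unitCost ℚ) inp σ ≤ B) :
    e.cost bitCost inp σ ≤ e.cost (unitCost ℚ) inp σ * (B + D.size + 2) := by
  have key : ∀ e : NExpr, e.constSum ≤ N → L + e.cost (unitCost ℚ) inp σ ≤ B →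
      bitCost.num (e.eval inp σ) ≤ B + D.size + 2 := fun e h1 h2 =>
    ((NExpr.eval_bound hσ hI e h1).mono h2).bitSize_le hI.pos
  have key' : ∀ x, FracBound D L x → L ≤ B → bitCost.num x ≤ B + D.size + 2 := fun x h1 h2 =>
    (h1.mono h2).bitSize_le hI.pos
  have ikey : ∀ e : IExpr, e.constSum ≤ N → L + e.cost (unitCost ℚ) σ ≤ B →
      e.cost bitCost σ ≤ e.cost (unitCost ℚ) σ * (B + D.size + 2) := fun e h1 h2 =>
    (IExpr.bit_cost_le hσ hI.idx e h1 h2).trans (Nat.mul_le_mul_left _ (by omega))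
  have h3 : ∀ k, (unitCost ℚ).num k = 1 := fun _ => rfl
  induction e with
  | const k => simpa [NExpr.cost, unitCost, NExpr.eval] using key _ he hB
  | inp a i j | get a i j =>
    have h0 := key _ he hB
    simp only [NExpr.constSum] at he
    simp only [NExpr.cost, NExpr.eval] at hB h0 ⊢
    have h1 := ikey i (by omega) (by omega)
    have h2 := ikey j (by omega) (by omega)
    rw [h3, add_mul, add_mul, one_mul]
    omega
  | prod a i j b k l =>
    have h0 := key _ he hB
    simp only [NExpr.constSum] at he
    simp only [NExpr.cost, NExpr.eval] at hB h0 ⊢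
    have h1 := ikey i (by omega) (by omega)
    have h2 := ikey j (by omega) (by omega)
    have h4 := ikey k (by omega) (by omega)
    have h5 := ikey l (by omega) (by omega)
    have h6 := key' _ (hI.input a (i.eval σ) (j.eval σ)) (by omega)
    have h7 := key' _ (hI.input b (k.eval σ) (l.eval σ)) (by omega)
    simp only [h3, add_mul, one_mul] at h0 h1 h2 h4 h5 h6 h7 ⊢
    omega
  | add e f ihe ihf | sub e f ihe ihf =>
    have h0 := key _ he hB
    simp only [NExpr.constSum] at he
    simp only [NExpr.cost, NExpr.eval] at hB h0 ⊢
    have h1 := ihe (by omega) (by omega)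
    have h2 := ihf (by omega) (by omega)
    rw [h3, add_mul, add_mul, one_mul]
    omega

theorem Test.bit_cost_le (hσ : StoreBound D L σ) (hI : InputBound D L N inp) (c : Test)
    (hc : c.constSum ≤ N) (hB : L + c.cost (unitCost ℚ) inp σ ≤ B) :
    c.cost bitCost inp σ ≤ c.cost (unitCost ℚ) inp σ * (B + D.size + 2) := by
  induction c with
  | ilt e f =>
    simp only [Test.constSum] at hc
    simp only [Test.cost] at hB ⊢
    have h1 := (IExpr.bit_cost_le (N := N) (B := B) hσ hI.idx e (by omega) (by omega)).trans
      (Nat.mul_le_mul_left _ (show B + 2 ≤ B + D.size + 2 by omega))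
    have h2 := (IExpr.bit_cost_le (N := N) (B := B) hσ hI.idx f (by omega) (by omega)).trans
      (Nat.mul_le_mul_left _ (show B + 2 ≤ B + D.size + 2 by omega))
    rw [add_mul, add_mul, one_mul]; omega
  | nlt e f =>
    simp only [Test.constSum] at hc
    simp only [Test.cost] at hB ⊢
    have h1 := NExpr.bit_cost_le hσ hI e (B := B) (by omega) (by omega)
    have h2 := NExpr.bit_cost_le hσ hI f (B := B) (by omega) (by omega)
    rw [add_mul, add_mul, one_mul]; omega
  | neg c ih =>
    simp only [Test.constSum] at hc
    simp only [Test.cost] at hB ⊢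
    have h1 := ih (by omega) (by omega)
    rw [add_mul, one_mul]; omega
  | and c d ihc ihd =>
    simp only [Test.constSum] at hc
    simp only [Test.cost] at hB ⊢
    have h1 := ihc (by omega) (by omega)
    have h2 := ihd (by omega) (by omega)
    rw [add_mul, add_mul, one_mul]; omega

theorem InputBound.mono (h : InputBound D L N inp) {L' : ℕ} (hL : L ≤ L') :
    InputBound D L' N inp :=
  ⟨h.pos, fun k hk => (h.const k hk).mono hL,
    h.idx.trans (pow_le_pow_right₀ (by norm_num) hL), fun a i j => (h.input a i j).mono hL,
    fun a i j b k l => (h.product a i j b k l).mono hL⟩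

/-- As numbers are only added and subtracted, a run of `t` elementary operations handles
numbers of `O(t)` more bits than the input. -/
theorem Exec.bit_of_unit {P : Prog} {τ : Store ℚ} {t : ℕ}
    (h : Exec (unitCost ℚ) inp P σ t τ) (hP : P.constSum ≤ N) (hI : InputBound D L N inp)
    (hσ : StoreBound D L σ) (hB : L + t ≤ B) :
    StoreBound D (L + t) τ ∧
      ∃ t', Exec bitCost inp P σ t' τ ∧ t' ≤ t * (B + D.size + 2) := by
  -- `L` varies because the second half of a sequence starts with the larger values left by the
  -- first half; `B` bounds the values of the entire run and stays fixed.
  induction h generalizing L with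
  | skip σ => exact ⟨hσ.mono (by omega), 1, .skip σ, by omega⟩
  | iset σ a i j e =>
    simp only [Prog.constSum] at hP
    have ikey : ∀ e : IExpr, e.constSum ≤ N → L + e.cost (unitCost ℚ) σ ≤ B →
        e.cost bitCost σ ≤ e.cost (unitCost ℚ) σ * (B + D.size + 2) := fun e h1 h2 =>
      (IExpr.bit_cost_le hσ hI.idx e h1 h2).trans (Nat.mul_le_mul_left _ (by omega))
    refine ⟨⟨fun a' i' j' => ?_, fun a' i' j' => (hσ.num a' i' j').mono (by omega)⟩,
      _, .iset σ a i j e, ?_⟩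
    · simp only [Store.setIdx]
      split_ifs
      · exact (IExpr.eval_le hσ hI.idx e (by omega)).trans
          (pow_le_pow_right₀ (by norm_num) (by omega))
      · exact (hσ.mono (by omega)).idx a' i' j'
    · have h1 := ikey i (by omega) (by omega)
      have h2 := ikey j (by omega) (by omega)
      have h3 := ikey e (by omega) (by omega)
      rw [add_mul, add_mul, add_mul, one_mul]
      omega
  | nset σ a i j e =>
    simp only [Prog.constSum] at hP
    have ikey : ∀ e : IExpr, e.constSum ≤ N → L + e.cost (unitCost ℚ) σ ≤ B →
        e.cost bitCost σ ≤ e.cost (unitCost ℚ) σ * (B + D.size + 2) := fun e h1 h2 =>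
      (IExpr.bit_cost_le hσ hI.idx e h1 h2).trans (Nat.mul_le_mul_left _ (by omega))
    refine ⟨⟨fun a' i' j' => (hσ.mono (by omega)).idx a' i' j', fun a' i' j' => ?_⟩,
      _, .nset σ a i j e, ?_⟩
    · simp only [Store.setNum]
      split_ifs
      · exact (NExpr.eval_bound hσ hI e (by omega)).mono (by omega)
      · exact (hσ.num a' i' j').mono (by omega)
    · have h1 := ikey i (by omega) (by omega)
      have h2 := ikey j (by omega) (by omega)
      have h3 := NExpr.bit_cost_le hσ hI e (B := B) (by omega) (by omega)
      rw [add_mul, add_mul, add_mul, one_mul]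
      omega
  | seq _ _ ih1 ih2 =>
    simp only [Prog.constSum] at hP
    obtain ⟨s1, t1, e1, b1⟩ := ih1 (by omega) hI hσ (by omega)
    obtain ⟨s2, t2, e2, b2⟩ := ih2 (by omega) (hI.mono (by omega)) s1 (by omega)
    refine ⟨s2.mono (by omega), _, .seq e1 e2, ?_⟩
    rw [add_mul]; omega
  | @ite_true c _ _ _ _ _ hc _ ih =>
    simp only [Prog.constSum] at hP
    obtain ⟨s1, t1, e1, b1⟩ := ih (by omega) hI hσ (by omega)
    have h2 := Test.bit_cost_le hσ hI c (B := B) (by omega) (by omega)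
    refine ⟨s1.mono (by omega), _, .ite_true hc e1, ?_⟩
    rw [add_mul, add_mul, one_mul]; omega
  | @ite_false c _ _ _ _ _ hc _ ih =>
    simp only [Prog.constSum] at hP
    obtain ⟨s1, t1, e1, b1⟩ := ih (by omega) hI hσ (by omega)
    have h2 := Test.bit_cost_le hσ hI c (B := B) (by omega) (by omega)
    refine ⟨s1.mono (by omega), _, .ite_false hc e1, ?_⟩
    rw [add_mul, add_mul, one_mul]; omega
  | @loop_true c _ _ _ _ _ _ hc _ _ ih1 ih2 =>
    simp only [Prog.constSum] at hP
    obtain ⟨s1, t1, e1, b1⟩ := ih1 (by omega) hI hσ (by omega)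
    obtain ⟨s2, t2, e2, b2⟩ := ih2 (by simp only [Prog.constSum]; omega)
      (hI.mono (by omega)) s1 (by omega)
    have h2 := Test.bit_cost_le hσ hI c (B := B) (by omega) (by omega)
    refine ⟨s2.mono (by omega), _, .loop_true hc e1 e2, ?_⟩
    rw [add_mul, add_mul, add_mul, one_mul]; omega
  | @loop_false c _ _ hc =>
    simp only [Prog.constSum] at hP
    have h2 := Test.bit_cost_le hσ hI c (B := B) (by omega) (by omega)
    refine ⟨hσ.mono (by omega), _, .loop_false hc, ?_⟩
    rw [add_mul, one_mul]; omega

end BitTransfer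

/-! ### A program logic for total correctness -/

section ProgramLogic

/-- Number of nodes of an expression. -/
def IExpr.size : IExpr → ℕ
  | .const _ => 1
  | .get _ i j => i.size + j.size + 1
  | .add e f => e.size + f.size + 1
  | .sub e f => e.size + f.size + 1

def NExpr.size : NExpr → ℕ
  | .const _ => 1
  | .inp _ i j => i.size + j.size + 1
  | .prod _ i j _ k l => i.size + j.size + 1 + (k.size + l.size + 1) + 1
  | .get _ i j => i.size + j.size + 1
  | .add e f => e.size + f.size + 1
  | .sub e f => e.size + f.size + 1

def Test.size : Test → ℕ
  | .ilt e f => e.size + f.size + 1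
  | .nlt e f => e.size + f.size + 1
  | .neg c => c.size + 1
  | .and c d => c.size + d.size + 1

/-- A bound for the number of elementary operations if no loop is iterated more than `X` times
in a row. -/
noncomputable def Prog.timePoly : Prog → Polynomial ℕ
  | .skip => 1
  | .iset _ i j e => ((i.size + j.size + e.size + 1 : ℕ) : Polynomial ℕ)
  | .nset _ i j e => ((i.size + j.size + e.size + 1 : ℕ) : Polynomial ℕ)
  | .seq p q => p.timePoly + q.timePoly
  | .ite c p q => ((c.size + 1 : ℕ) : Polynomial ℕ) + p.timePoly + q.timePoly
  | .loop c p => Polynomial.X * (((c.size + 1 : ℕ) : Polynomial ℕ) + p.timePoly) +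
      ((c.size + 1 : ℕ) : Polynomial ℕ)

/-- Index arrays that a program may overwrite. -/
def Prog.idxWrites : Prog → List ℕ
  | .skip => []
  | .iset a _ _ _ => [a]
  | .nset _ _ _ _ => []
  | .seq p q => p.idxWrites ++ q.idxWrites
  | .ite _ p q => p.idxWrites ++ q.idxWrites
  | .loop _ p => p.idxWrites

/-- Number arrays that a program may overwrite. -/
def Prog.numWrites : Prog → List ℕ
  | .skip => []
  | .iset _ _ _ _ => []
  | .nset a _ _ _ => [a]
  | .seq p q => p.numWrites ++ q.numWrites
  | .ite _ p q => p.numWrites ++ q.numWrites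
  | .loop _ p => p.numWrites

variable {K : Type}

@[simp] theorem unitCost_idx (k : ℕ) : (unitCost K).idx k = 1 := rfl

@[simp] theorem unitCost_num (x : K) : (unitCost K).num x = 1 := rfl

theorem IExpr.unit_cost (σ : Store K) (e : IExpr) : e.cost (unitCost K) σ = e.size := by
  induction e with
  | const k => rfl
  | get a i j ihe ihf | add i j ihe ihf | sub i j ihe ihf =>
    simp [IExpr.cost, IExpr.size, ihe, ihf]

variable {σ : Store K}

/-- Column `0` of an index array. -/
def Store.col (σ : Store K) (a : ℕ) : ℕ → ℕ := fun i => σ.idx a i 0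

/-- Column `0` of a number array. -/
def Store.ncol (σ : Store K) (a : ℕ) : ℕ → K := fun i => σ.num a i 0

@[simp] theorem Store.col_setIdx_self (a i v : ℕ) :
    (σ.setIdx a i 0 v).col a = Function.update (σ.col a) i v := by
  funext k
  simp [Store.col, Store.setIdx, Function.update_apply]

theorem Store.col_setIdx_of_ne {a b : ℕ} (h : b ≠ a) (i j v : ℕ) :
    (σ.setIdx a i j v).col b = σ.col b := by
  funext k
  simp [Store.col, Store.setIdx, h]

theorem Store.idx_setIdx_of_ne {a b : ℕ} (h : b ≠ a) (i j v : ℕ) :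
    (σ.setIdx a i j v).idx b = σ.idx b := by
  funext k l
  simp [Store.setIdx, h]

@[simp] theorem Store.ncol_setIdx (a b i j v : ℕ) :
    (σ.setIdx a i j v).ncol b = σ.ncol b := rfl

@[simp] theorem Store.ncol_setNum_self (a i : ℕ) (v : K) :
    (σ.setNum a i 0 v).ncol a = Function.update (σ.ncol a) i v := by
  funext k
  simp [Store.ncol, Store.setNum, Function.update_apply]

theorem Store.ncol_setNum_of_ne {a b : ℕ} (h : b ≠ a) (i j : ℕ) (v : K) :
    (σ.setNum a i j v).ncol b = σ.ncol b := by
  funext k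
  simp [Store.ncol, Store.setNum, h]

@[simp] theorem Store.col_setNum (a b i j : ℕ) (v : K) :
    (σ.setNum a i j v).col b = σ.col b := rfl

/-- The scalar variable stored at the origin of an index array. -/
def var (v : ℕ) : IExpr := .get v (.const 0) (.const 0)

/-- An entry in column `0` of an index array. -/
def cell (a : ℕ) (e : IExpr) : IExpr := .get a e (.const 0)

/-- An entry in column `0` of a number array. -/
def ncell (a : ℕ) (e : IExpr) : NExpr := .get a e (.const 0)

@[simp] theorem eval_var (v : ℕ) : (var v).eval σ = σ.col v 0 := rfl

@[simp] theorem eval_cell (a : ℕ) (e : IExpr) :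
    (cell a e).eval σ = σ.col a (e.eval σ) := rfl

@[simp] theorem eval_const (k : ℕ) : (IExpr.const k).eval σ = k := rfl

theorem Store.col_eq {τ : Store K} {a : ℕ} (h : τ.idx a = σ.idx a) : τ.col a = σ.col a := by
  unfold Store.col; rw [h]

theorem Store.ncol_eq {τ : Store K} {a : ℕ} (h : τ.num a = σ.num a) :
    τ.ncol a = σ.ncol a := by
  unfold Store.ncol; rw [h]

variable [Field K]

@[simp] theorem eval_ncell (inp : ℕ → ℕ → ℕ → K) (a : ℕ) (e : IExpr) :
    (ncell a e).eval inp σ = σ.ncol a (e.eval σ) := rfl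

theorem NExpr.unit_cost (inp : ℕ → ℕ → ℕ → K) (σ : Store K) (e : NExpr) :
    e.cost (unitCost K) inp σ = e.size := by
  induction e with
  | const k => rfl
  | inp | get | prod => simp [NExpr.cost, NExpr.size, IExpr.unit_cost]
  | add i j ihe ihf | sub i j ihe ihf =>
    simp [NExpr.cost, NExpr.size, ihe, ihf]

theorem Test.unit_cost (inp : ℕ → ℕ → ℕ → K) (σ : Store K) (c : Test) :
    c.cost (unitCost K) inp σ = c.size := by
  induction c with
  | ilt | nlt => simp [Test.cost, Test.size, IExpr.unit_cost, NExpr.unit_cost]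
  | neg c ih => simp [Test.cost, Test.size, ih]
  | and c d ih ih' => simp [Test.cost, Test.size, ih, ih']

variable [LinearOrder K]

/-- A frame rule read off the syntax: specifications of subprograms can then be silent about all
arrays that are not written. -/
theorem Exec.idx_eq {w : CostModel K} {inp : ℕ → ℕ → ℕ → K} {P : Prog} {σ τ : Store K} {t : ℕ}
    (h : Exec w inp P σ t τ) : ∀ a ∉ P.idxWrites, τ.idx a = σ.idx a := by
  induction h with
  | skip | nset | loop_false => intro a _; rfl
  | iset σ b i j e =>
    intro a ha
    simp only [Prog.idxWrites, List.mem_singleton] at ha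
    simp [Store.setIdx, ha]
  | seq _ _ ih1 ih2 =>
    intro a ha
    simp only [Prog.idxWrites, List.mem_append, not_or] at ha
    rw [ih2 a ha.2, ih1 a ha.1]
  | ite_true _ _ ih =>
    intro a ha
    simp only [Prog.idxWrites, List.mem_append, not_or] at ha
    exact ih a ha.1
  | ite_false _ _ ih =>
    intro a ha
    simp only [Prog.idxWrites, List.mem_append, not_or] at ha
    exact ih a ha.2
  | loop_true _ _ _ ih1 ih2 =>
    intro a ha
    rw [ih2 a ha, ih1 a ha]

theorem Exec.num_eq {w : CostModel K} {inp : ℕ → ℕ → ℕ → K} {P : Prog} {σ τ : Store K} {t : ℕ}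
    (h : Exec w inp P σ t τ) : ∀ a ∉ P.numWrites, τ.num a = σ.num a := by
  induction h with
  | skip | iset | loop_false => intro a _; rfl
  | nset σ b i j e =>
    intro a ha
    simp only [Prog.numWrites, List.mem_singleton] at ha
    simp [Store.setNum, ha]
  | seq _ _ ih1 ih2 =>
    intro a ha
    simp only [Prog.numWrites, List.mem_append, not_or] at ha
    rw [ih2 a ha.2, ih1 a ha.1]
  | ite_true _ _ ih =>
    intro a ha
    simp only [Prog.numWrites, List.mem_append, not_or] at ha
    exact ih a ha.1
  | ite_false _ _ ih =>
    intro a ha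
    simp only [Prog.numWrites, List.mem_append, not_or] at ha
    exact ih a ha.2
  | loop_true _ _ _ ih1 ih2 =>
    intro a ha
    rw [ih2 a ha, ih1 a ha]

/-- `P` halts in a store with the property `Q`, within the time bound for loops that are
iterated at most `N` times. -/
def Runs (N : ℕ) (inp : ℕ → ℕ → ℕ → K) (P : Prog) (σ : Store K) (Q : Store K → Prop) : Prop :=
  ∃ t τ, Exec (unitCost K) inp P σ t τ ∧ t ≤ P.timePoly.eval N ∧ Q τ

variable {N : ℕ} {inp : ℕ → ℕ → ℕ → K} {Q R : Store K → Prop}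

theorem Runs.imp {P : Prog} (h : Runs N inp P σ R) (hQ : ∀ τ, R τ → Q τ) :
    Runs N inp P σ Q := by
  obtain ⟨t, τ, h1, h2, h3⟩ := h
  exact ⟨t, τ, h1, h2, hQ τ h3⟩

theorem Runs.frame {P : Prog} (h : Runs N inp P σ R)
    (hQ : ∀ τ, R τ → (∀ a ∉ P.idxWrites, τ.idx a = σ.idx a) →
      (∀ a ∉ P.numWrites, τ.num a = σ.num a) → Q τ) : Runs N inp P σ Q := by
  obtain ⟨t, τ, h1, h2, h3⟩ := h
  exact ⟨t, τ, h1, h2, hQ τ h3 h1.idx_eq h1.num_eq⟩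

theorem Runs.skip (h : Q σ) : Runs N inp .skip σ Q :=
  ⟨1, σ, .skip σ, by simp [Prog.timePoly], h⟩

theorem Runs.iset {a : ℕ} {i j e : IExpr}
    (h : Q (σ.setIdx a (i.eval σ) (j.eval σ) (e.eval σ))) : Runs N inp (.iset a i j e) σ Q :=
  ⟨_, _, .iset σ a i j e, by simp [Prog.timePoly, IExpr.unit_cost], h⟩

theorem Runs.nset {a : ℕ} {i j : IExpr} {e : NExpr}
    (h : Q (σ.setNum a (i.eval σ) (j.eval σ) (e.eval inp σ))) :
    Runs N inp (.nset a i j e) σ Q :=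
  ⟨_, _, .nset σ a i j e, by simp [Prog.timePoly, IExpr.unit_cost, NExpr.unit_cost], h⟩

theorem Runs.seq {p q : Prog} (h : Runs N inp p σ fun τ => Runs N inp q τ Q) :
    Runs N inp (.seq p q) σ Q := by
  obtain ⟨t, τ, h1, h2, t', ρ, h3, h4, h5⟩ := h
  exact ⟨t + t', ρ, .seq h1 h3, by simp [Prog.timePoly]; omega, h5⟩

theorem Runs.ite {c : Test} {p q : Prog} (hp : c.Holds inp σ → Runs N inp p σ Q)
    (hq : ¬ c.Holds inp σ → Runs N inp q σ Q) : Runs N inp (.ite c p q) σ Q := by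
  by_cases hc : c.Holds inp σ
  · obtain ⟨t, τ, h1, h2, h3⟩ := hp hc
    refine ⟨_, τ, .ite_true hc h1, ?_, h3⟩
    simp [Prog.timePoly, Test.unit_cost]; omega
  · obtain ⟨t, τ, h1, h2, h3⟩ := hq hc
    refine ⟨_, τ, .ite_false hc h1, ?_, h3⟩
    simp [Prog.timePoly, Test.unit_cost]; omega

/-- `μ` is a variant: it drops in each iteration, so its initial value bounds their number. The body
may also use that arrays it never writes are as they were on entry to the loop. -/
theorem Runs.loop {c : Test} {p : Prog} (I : Store K → Prop) (μ : Store K → ℕ)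
    (h0 : I σ) (hμ : μ σ ≤ N)
    (step : ∀ τ, I τ → c.Holds inp τ → (∀ a ∉ p.idxWrites, τ.idx a = σ.idx a) →
      (∀ a ∉ p.numWrites, τ.num a = σ.num a) → Runs N inp p τ fun ρ => I ρ ∧ μ ρ < μ τ) :
    Runs N inp (.loop c p) σ fun τ => I τ ∧ ¬ c.Holds inp τ := by
  have key : ∀ k, ∀ ρ, I ρ → (∀ a ∉ p.idxWrites, ρ.idx a = σ.idx a) →
      (∀ a ∉ p.numWrites, ρ.num a = σ.num a) → μ ρ ≤ k →
      ∃ t τ, Exec (unitCost K) inp (.loop c p) ρ t τ ∧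
      t ≤ k * (c.size + 1 + p.timePoly.eval N) + (c.size + 1) ∧ I τ ∧ ¬ c.Holds inp τ := by
    intro k
    induction k with
    | zero =>
      intro ρ hρ hi hn hk
      -- With variant `0` another iteration would have to make it smaller still.
      have hc : ¬ c.Holds inp ρ := by
        intro hc
        obtain ⟨_, _, _, _, _, h⟩ := step ρ hρ hc hi hn
        omega
      exact ⟨_, ρ, .loop_false hc, by simp [Test.unit_cost], hρ, hc⟩
    | succ k ih =>
      intro ρ hρ hi hn hk
      by_cases hc : c.Holds inp ρ
      · obtain ⟨t, π, h1, h2, h3, h4⟩ := step ρ hρ hc hi hn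
        obtain ⟨t', τ, h5, h6, h7⟩ := ih π h3
          (fun a ha => (h1.idx_eq a ha).trans (hi a ha))
          (fun a ha => (h1.num_eq a ha).trans (hn a ha)) (by omega)
        refine ⟨_, τ, .loop_true hc h1 h5, ?_, h7⟩
        rw [Test.unit_cost, add_mul, one_mul]
        omega
      · exact ⟨_, ρ, .loop_false hc, by simp [Test.unit_cost], hρ, hc⟩
  obtain ⟨t, τ, h1, h2, h3⟩ := key N σ h0 (fun _ _ => rfl) (fun _ _ => rfl) hμ
  exact ⟨t, τ, h1, by simpa [Prog.timePoly] using h2, h3⟩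

/-- `for v < b do body` -/
def forLoop (v : ℕ) (b : IExpr) (body : Prog) : Prog :=
  .seq (.iset v (.const 0) (.const 0) (.const 0))
    (.loop (.ilt (var v) b)
      (.seq body (.iset v (.const 0) (.const 0) (.add (var v) (.const 1)))))

/-- The condition `hset` makes the invariant blind to the counter's array, so that resetting and
incrementing the counter preserve it; `hb` fixes the bound even though it is evaluated anew in each
round. -/
theorem Runs.forLoop {v k : ℕ} {b : IExpr} {body : Prog} (I : ℕ → Store K → Prop)
    (hv : v ∉ body.idxWrites) (hk : k ≤ N)
    (hset : ∀ i τ x, I i τ → I i (τ.setIdx v 0 0 x)) (h0 : I 0 σ)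
    (hb : ∀ τ : Store K, (∀ a ∉ v :: body.idxWrites, τ.idx a = σ.idx a) → b.eval τ = k)
    (step : ∀ i < k, ∀ τ, I i τ → τ.col v 0 = i → (∀ a ∉ v :: body.idxWrites, τ.idx a = σ.idx a) →
      (∀ a ∉ body.numWrites, τ.num a = σ.num a) → Runs N inp body τ (I (i + 1))) :
    Runs N inp (forLoop v b body) σ (I k) := by
  refine Runs.seq (Runs.iset ?_)
  have hframe : ∀ τ : Store K,
      (∀ a ∉ (Prog.seq body (.iset v (.const 0) (.const 0) (.add (var v) (.const 1)))).idxWrites,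
        τ.idx a = (σ.setIdx v 0 0 0).idx a) →
      ∀ a ∉ v :: body.idxWrites, τ.idx a = σ.idx a := by
    intro τ hi a ha
    rw [List.mem_cons, not_or] at ha
    rw [hi a (by simp [Prog.idxWrites, ha]), Store.idx_setIdx_of_ne ha.1]
  refine (Runs.loop (fun τ => τ.col v 0 ≤ k ∧ I (τ.col v 0) τ) (fun τ => k - τ.col v 0)
    ?_ (by omega) ?_).frame ?_
  · simpa [IExpr.eval] using hset 0 σ 0 h0
  · intro τ ⟨h1, h2⟩ hc hi hn
    have hi' := hframe τ hi
    have hlt : τ.col v 0 < k := by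
      have : (var v).eval τ < b.eval τ := hc
      rwa [hb τ hi'] at this
    have hn' : ∀ a ∉ body.numWrites, τ.num a = σ.num a := fun a ha =>
      hn a (by simp [Prog.numWrites, ha])
    refine Runs.seq ((step _ hlt τ h2 rfl hi' hn').frame fun ρ hρ hi _ => Runs.iset ?_)
    have hcol : ρ.col v 0 = τ.col v 0 := by simp [Store.col, hi v hv]
    have he : (IExpr.add (var v) (.const 1)).eval ρ = τ.col v 0 + 1 := by
      rw [← hcol]; rfl
    rw [he]
    simp only [IExpr.eval, Store.col_setIdx_self, Function.update_self]
    exact ⟨⟨hlt, hset _ _ _ hρ⟩, by omega⟩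
  · intro τ ⟨⟨h1, h2⟩, h3⟩ hi _
    have : ¬ (var v).eval τ < b.eval τ := h3
    rw [hb τ (hframe τ hi)] at this
    have h4 : τ.col v 0 = k := by
      have : ¬ τ.col v 0 < k := this
      omega
    rwa [h4] at h2

end ProgramLogic

/-! ### The primal-dual method -/

section PrimalDual

/-- A market whose flights and slots are numbered; `w` holds the costs of the delays. -/
structure NumberedMarket (K : Type) where
  n : ℕ
  m : ℕ
  win : ℕ → ℕ → Prop
  w : ℕ → ℕ → K
  cap : ℕ → ℕ

/-- Number of flights in slot `s`. -/
def load (n : ℕ) (a : ℕ → ℕ) (s : ℕ) : ℕ := ((Finset.range n).filter fun i => a i = s).card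

/-- Stated as a balance of sums to avoid truncated subtraction; this also covers the case where the
flight does not move. -/
theorem load_update {n : ℕ} {a : ℕ → ℕ} {i : ℕ} (hi : i < n) (v s : ℕ) :
    load n (Function.update a i v) s + (if s = a i then 1 else 0) =
      load n a s + (if s = v then 1 else 0) := by
  have hmem : i ∈ Finset.range n := Finset.mem_range.mpr hi
  unfold load
  rw [Finset.card_filter, Finset.card_filter, ← Finset.add_sum_erase _ _ hmem,
    ← Finset.add_sum_erase _ _ hmem]
  have : ∑ x ∈ (Finset.range n).erase i, (if Function.update a i v x = s then 1 else 0) =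
      ∑ x ∈ (Finset.range n).erase i, (if a x = s then 1 else 0) := by
    refine Finset.sum_congr rfl fun x hx => ?_
    rw [Function.update_of_ne (Finset.ne_of_mem_erase hx)]
  rw [this, Function.update_self]
  simp only [eq_comm (a := s)]
  omega

variable {K : Type} [Field K]

/-- Slot `s` was reached in the search tree by a tight edge from the flight `par s`, which is
in a slot that was reached before. -/
def IsTreeEdge (M : NumberedMarket K) (a ord par : ℕ → ℕ) (p t : ℕ → K) (s : ℕ) : Prop :=
  par s < M.n ∧ M.win (par s) s ∧ 0 < ord (a (par s)) ∧ ord (a (par s)) < ord s ∧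
    t (par s) = p s + M.w (par s) s

/-- Invariant while the flights are moved along the path of the tree that ends in `bs`: the slot
`cur` has been vacated (or is `bs`). -/
structure FlipInv (M : NumberedMarket K) (bs : ℕ) (a₀ ord par : ℕ → ℕ) (p t : ℕ → K)
    (a : ℕ → ℕ) (cur : ℕ) : Prop where
  le : ∀ i < M.n, a i ≤ M.m
  win : ∀ i < M.n, a i < M.m → M.win i (a i)
  tight : ∀ i < M.n, a i < M.m → t i = p (a i) + M.w i (a i)
  load_eq : ∀ s ≤ M.m, load M.n a s + (if s = cur then 1 else 0) =
    load M.n a₀ s + (if s = bs then 1 else 0)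
  -- Only the part of the tree numbered up to `cur` is kept: edges with larger numbers may be
  -- spoiled by the flights already moved, but the rest of the path does not need them.
  tree : ∀ s < M.m, 0 < ord s → ord s ≤ ord cur → IsTreeEdge M a ord par p t s
  cur_le : cur ≤ M.m
  cur_pos : 0 < ord cur

variable {M : NumberedMarket K} {a ord par : ℕ → ℕ} {p t : ℕ → K}

/-- The parent flight of `cur` moves in along its tight edge and vacates a slot with a smaller
number, so the walk descends to the root. -/
theorem FlipInv.step {bs cur : ℕ} {a₀ : ℕ → ℕ} (h : FlipInv M bs a₀ ord par p t a cur)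
    (hc : cur < M.m) :
    FlipInv M bs a₀ ord par p t (Function.update a (par cur) cur) (a (par cur)) ∧
      ord (a (par cur)) < ord cur := by
  obtain ⟨h1, h2, h3, h4, h5⟩ := h.tree cur hc h.cur_pos le_rfl
  refine ⟨⟨?_, ?_, ?_, ?_, ?_, h.le _ h1, h3⟩, h4⟩
  · intro i hi
    by_cases hip : i = par cur
    · rw [hip, Function.update_self]; exact hc.le
    · rw [Function.update_of_ne hip]; exact h.le i hi
  · intro i hi
    by_cases hip : i = par cur
    · rw [hip, Function.update_self]; exact fun _ => h2
    · rw [Function.update_of_ne hip]; exact h.win i hi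
  · intro i hi
    by_cases hip : i = par cur
    · rw [hip, Function.update_self]; exact fun _ => h5
    · rw [Function.update_of_ne hip]; exact h.tight i hi
  · intro s hs
    rw [load_update h1, h.load_eq s hs]
  · intro s hs hos hle
    obtain ⟨g1, g2, g3, g4, g5⟩ := h.tree s hs hos (by omega)
    -- The parent of `s` sits in a slot numbered below `s`, hence below the slot the moved flight
    -- has just left.
    have hne : par s ≠ par cur := by
      intro he
      rw [he] at g4; omega
    exact ⟨g1, g2, by rwa [Function.update_of_ne hne], by rwa [Function.update_of_ne hne], g5⟩

variable [LinearOrder K]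

/-- Invariant of the primal-dual method. Unassigned flights are in the virtual slot `M.m`, which
is the root of the search tree. `ord` numbers the slots of the tree, and is `0` elsewhere.
The slots of the tree are filled, with the possible exception of `x`. -/
structure PDInv (M : NumberedMarket K) (x : ℕ) (a ord par : ℕ → ℕ) (p t spare : ℕ → K)
    (c left : ℕ) : Prop where
  le : ∀ i < M.n, a i ≤ M.m
  win : ∀ i < M.n, a i < M.m → M.win i (a i)
  tight : ∀ i < M.n, a i < M.m → t i = p (a i) + M.w i (a i)
  load_le : ∀ s < M.m, load M.n a s ≤ M.cap s
  spare_eq : ∀ s < M.m, spare s = M.cap s - load M.n a s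
  price_nonneg : ∀ s < M.m, 0 ≤ p s
  free : ∀ s < M.m, load M.n a s < M.cap s → p s = 0
  -- The first alternative lets unassigned flights carry arbitrary costs `t i` while the tree is
  -- only the root; the first raise of the duals repairs this, so `t` needs no initial values.
  slack : ∀ i < M.n, ∀ s < M.m, M.win i s →
    (a i = M.m ∧ ∀ s < M.m, ord s = 0) ∨ t i ≤ p s + M.w i s
  tree : ∀ s < M.m, 0 < ord s → IsTreeEdge M a ord par p t s
  root : ord M.m = 1
  ord_le : ∀ s < M.m, ord s ≤ c
  c_pos : 1 ≤ c
  -- `c` includes the root, hence the total `M.m + 1`.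
  count : c + ((Finset.range M.m).filter fun s => ord s = 0).card = M.m + 1
  left_eq : left = load M.n a M.m
  full : ∀ s < M.m, 0 < ord s → M.cap s ≤ load M.n a s ∨ s = x

variable {x : ℕ} {spare : ℕ → K} {c left : ℕ}

/-- Raising the duals of the tree until a new slot `bs` can be reached. -/
theorem PDInv.grow [IsStrictOrderedRing K] (h : PDInv M M.m a ord par p t spare c left) {bi bs : ℕ} {δ : K}
    (hbi : bi < M.n) (hbs : bs < M.m) (hwin : M.win bi bs) (hT : 0 < ord (a bi))
    (hnT : ord bs = 0) (hδ : δ = p bs + M.w bi bs - t bi)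
    (hmin : ∀ i < M.n, ∀ s < M.m, M.win i s → 0 < ord (a i) → ord s = 0 →
      δ ≤ p s + M.w i s - t i)
    {p' t' : ℕ → K} (hp : ∀ s < M.m, p' s = if 0 < ord s then p s + δ else p s)
    (ht : ∀ i < M.n, t' i = if 0 < ord (a i) then t i + δ else t i) :
    PDInv M bs a (Function.update ord bs (c + 1)) (Function.update par bs bi) p' t' spare
      (c + 1) left := by
  -- A negative `δ` is possible only while the tree is just the root. Then no price changes, and
  -- lowering the costs of the unassigned flights is what makes their edges feasible.
  have hδ0 : (∀ s < M.m, ord s = 0) ∨ 0 ≤ δ := by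
    rcases h.slack bi hbi bs hbs hwin with h1 | h1
    · exact Or.inl h1.2
    · right; rw [hδ]; linarith
  have ham : ∀ i < M.n, 0 < ord (a i) → a i ≠ bs := by
    intro i hi h1 h2
    rw [h2] at h1; omega
  -- If both ends of the edge lie in the tree, they rise together; if only the flight does,
  -- minimality of `δ` applies; if only the slot does, the slack grows because `δ` is nonnegative.
  have hslack : ∀ i < M.n, ∀ s < M.m, M.win i s → t' i ≤ p' s + M.w i s := by
    intro i hi s hs hw
    rw [hp s hs, ht i hi]
    have h1 := h.slack i hi s hs hw
    by_cases hF : 0 < ord (a i) <;> by_cases hS : 0 < ord s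
    · simp only [hF, hS, if_true]
      rcases h1 with h1 | h1
      · have := h1.2 s hs; omega
      · linarith
    · simp only [hF, hS, if_true, if_false]
      have := hmin i hi s hs hw hF (by omega)
      linarith
    · simp only [hF, hS, if_true, if_false]
      rcases h1 with h1 | h1
      · have := h1.2 s hs; omega
      · rcases hδ0 with h2 | h2
        · have := h2 s hs; omega
        · linarith
    · simp only [hF, hS, if_false]
      rcases h1 with h1 | h1
      · rw [h1.1, h.root] at hF; omega
      · exact h1
  exact
  { le := h.le
    win := h.win
    tight := by
      intro i hi hai
      rw [hp _ hai, ht i hi, h.tight i hi hai]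
      split_ifs <;> ring
    load_le := h.load_le
    spare_eq := h.spare_eq
    price_nonneg := by
      intro s hs
      rw [hp s hs]
      split_ifs with h1
      · rcases hδ0 with h2 | h2
        · have := h2 s hs; omega
        · have := h.price_nonneg s hs; linarith
      · exact h.price_nonneg s hs
    free := by
      intro s hs hl
      rw [hp s hs]
      split_ifs with h1
      -- A slot whose price is raised was in the old tree, where every slot is filled, so it is not
      -- an unfilled slot.
      · rcases h.full s hs h1 with h2 | h2 <;> omega
      · exact h.free s hs hl
    slack := fun i hi s hs hw => Or.inr (hslack i hi s hs hw)
    tree := by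
      intro s hs hos
      by_cases hsb : s = bs
      · subst hsb
        refine ⟨by simpa using hbi, by simpa using hwin, ?_, ?_, ?_⟩
        · simpa [Function.update_of_ne (ham bi hbi hT)] using hT
        · simp only [Function.update_self, Function.update_of_ne (ham bi hbi hT)]
          rcases (h.le bi hbi).lt_or_eq with h1 | h1
          · have := h.ord_le _ h1; omega
          · rw [h1, h.root]; have := h.c_pos; omega
        · simp only [Function.update_self]
          rw [hp s hs, ht bi hbi, if_pos hT, if_neg (by omega), hδ]; ring
      · rw [Function.update_of_ne hsb] at hos
        obtain ⟨h1, h2, h3, h4, h5⟩ := h.tree s hs hos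
        have h6 := ham _ h1 h3
        refine ⟨?_, ?_, ?_, ?_, ?_⟩ <;> simp only [Function.update_of_ne hsb,
          Function.update_of_ne h6]
        · exact h1
        · exact h2
        · exact h3
        · exact h4
        · rw [hp s hs, ht _ h1, if_pos h3, if_pos hos, h5]; ring
    root := by rw [Function.update_of_ne (by omega)]; exact h.root
    ord_le := by
      intro s hs
      by_cases hsb : s = bs
      · simp [hsb]
      · rw [Function.update_of_ne hsb]; have := h.ord_le s hs; omega
    c_pos := by omega
    count := by
      have h1 : (Finset.range M.m).filter (fun s => Function.update ord bs (c + 1) s = 0) =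
          ((Finset.range M.m).filter fun s => ord s = 0).erase bs := by
        ext s
        by_cases hsb : s = bs <;> simp [hsb]
      have h2 : bs ∈ (Finset.range M.m).filter fun s => ord s = 0 := by simp [hbs, hnT]
      have h3 := Finset.card_erase_add_one h2
      have h4 := h.count
      rw [h1]; omega
    left_eq := h.left_eq
    full := by
      intro s hs hos
      by_cases hsb : s = bs
      · exact Or.inr hsb
      · rw [Function.update_of_ne hsb] at hos
        rcases h.full s hs hos with h2 | h2
        · exact Or.inl h2
        · omega }

theorem PDInv.of_filled (h : PDInv M x a ord par p t spare c left)
    (hx : M.cap x ≤ load M.n a x) : PDInv M M.m a ord par p t spare c left :=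
  { h with
    full := by
      intro s hs hos
      rcases h.full s hs hos with h1 | h1
      · exact Or.inl h1
      · subst h1; exact Or.inl hx }

theorem FlipInv.init (h : PDInv M x a ord par p t spare c left) {bs : ℕ} (hbs : bs < M.m)
    (hord : 0 < ord bs) : FlipInv M bs a ord par p t a bs :=
  ⟨h.le, h.win, h.tight, fun _ _ => rfl, fun s hs h1 _ => h.tree s hs h1, hbs.le, hord⟩

/-- One more flight has been assigned, and the tree is reset. -/
theorem FlipInv.finish {bs : ℕ} {a₀ : ℕ → ℕ}
    (h : FlipInv M bs a₀ ord par p t a M.m)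
    (h₀ : PDInv M bs a₀ ord par p t spare c left) (hbs : bs < M.m) (hord : 0 < ord bs)
    (hlt : load M.n a₀ bs < M.cap bs) {ord' : ℕ → ℕ} (hord' : ∀ s < M.m, ord' s = 0)
    (hroot : ord' M.m = 1) :
    0 < left ∧ PDInv M M.m a ord' par p t (Function.update spare bs (spare bs - 1)) 1
      (left - 1) := by
  have hload : ∀ s < M.m, load M.n a s = load M.n a₀ s + (if s = bs then 1 else 0) := by
    intro s hs
    have := h.load_eq s hs.le
    rwa [if_neg (by omega), add_zero] at this
  have hleft : load M.n a M.m + 1 = left := by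
    have := h.load_eq M.m le_rfl
    rwa [if_pos rfl, if_neg (by omega), add_zero, ← h₀.left_eq] at this
  refine ⟨by omega, ?_⟩
  exact
  { le := h.le
    win := h.win
    tight := h.tight
    load_le := by
      intro s hs
      rw [hload s hs]
      split_ifs with h1
      · rw [h1]; omega
      · exact h₀.load_le s hs
    spare_eq := by
      intro s hs
      rw [hload s hs]
      by_cases h1 : s = bs
      · rw [h1, Function.update_self, h₀.spare_eq bs hbs, if_pos rfl]; push_cast; ring
      · rw [Function.update_of_ne h1, h₀.spare_eq s hs, if_neg h1]; push_cast; ring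
    price_nonneg := h₀.price_nonneg
    free := by
      intro s hs hl
      rw [hload s hs] at hl
      exact h₀.free s hs (by omega)
    slack := by
      intro i hi s hs hw
      right
      rcases h₀.slack i hi s hs hw with h1 | h1
      -- The tree contains `bs`, so the exceptional alternative is already excluded and the slack
      -- condition survives the reset of the tree.
      · have := h1.2 bs hbs; omega
      · exact h1
    tree := by
      intro s hs h1
      rw [hord' s hs] at h1; omega
    root := hroot
    ord_le := by
      intro s hs
      rw [hord' s hs]; omega
    c_pos := le_rfl
    count := by
      have : (Finset.range M.m).filter (fun s => ord' s = 0) = Finset.range M.m := by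
        rw [Finset.filter_eq_self]
        intro s hs
        exact hord' s (Finset.mem_range.mp hs)
      rw [this, Finset.card_range, add_comm]
    left_eq := by omega
    full := by
      intro s hs h1
      rw [hord' s hs] at h1; omega }

/-- A schedule of a numbered market. -/
def NumberedMarket.IsSchedule (M : NumberedMarket K) (b : ℕ → ℕ) : Prop :=
  (∀ i < M.n, b i < M.m ∧ M.win i (b i)) ∧ ∀ s < M.m, load M.n b s ≤ M.cap s

/-- If the tree cannot be extended, then it violates Hall's condition. -/
theorem PDInv.infeasible (h : PDInv M M.m a ord par p t spare c left) (hleft : 0 < left)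
    (hstuck : ∀ i < M.n, ∀ s < M.m, M.win i s → 0 < ord (a i) → 0 < ord s) (b : ℕ → ℕ) :
    ¬ M.IsSchedule b := by
  rintro ⟨hb, hcap⟩
  set F := (Finset.range M.n).filter fun i => 0 < ord (a i) with hF
  set T := (Finset.range M.m).filter fun s => 0 < ord s with hTdef
  have hm : M.m ∉ T := by simp [hTdef]
  -- The flights `F` of the tree are counted by their present slots, root included: at least `left >
  -- 0` more than the capacities of `T`. The schedule `b` would have to place all of `F` within `T`.
  have h1 : F.card = ∑ s ∈ insert M.m T, (F.filter fun i => a i = s).card := by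
    refine Finset.card_eq_sum_card_fiberwise ?_
    intro i hi
    have hi' : i < M.n ∧ 0 < ord (a i) := by simpa [hF] using hi
    rcases (h.le i hi'.1).lt_or_eq with h2 | h2
    · simp [hTdef, h2, hi'.2]
    · simp [h2]
  have h2 : ∀ s ∈ insert M.m T, (F.filter fun i => a i = s).card = load M.n a s := by
    intro s hs
    have hos : 0 < ord s := by
      rcases Finset.mem_insert.mp hs with h3 | h3
      · rw [h3, h.root]; omega
      · exact (Finset.mem_filter.mp h3).2
    unfold load
    congr 1
    ext i
    simp only [hF, Finset.mem_filter, Finset.mem_range]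
    constructor
    · rintro ⟨⟨h3, _⟩, h4⟩; exact ⟨h3, h4⟩
    · rintro ⟨h3, h4⟩; exact ⟨⟨h3, by rw [h4]; exact hos⟩, h4⟩
  rw [Finset.sum_congr rfl h2, Finset.sum_insert hm, ← h.left_eq] at h1
  have h3 : ∑ s ∈ T, M.cap s ≤ ∑ s ∈ T, load M.n a s := by
    refine Finset.sum_le_sum fun s hs => ?_
    obtain ⟨hs1, hs2⟩ := Finset.mem_filter.mp hs
    have hs1 := Finset.mem_range.mp hs1
    rcases h.full s hs1 hs2 with h4 | h4
    · exact h4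
    · omega
  have h4 : F.card = ∑ s ∈ T, (F.filter fun i => b i = s).card := by
    refine Finset.card_eq_sum_card_fiberwise ?_
    intro i hi
    have hi' : i < M.n ∧ 0 < ord (a i) := by simpa [hF] using hi
    obtain ⟨hb1, hb2⟩ := hb i hi'.1
    simp [hTdef, hb1, hstuck i hi'.1 _ hb1 hb2 hi'.2]
  have h5 : ∑ s ∈ T, (F.filter fun i => b i = s).card ≤ ∑ s ∈ T, M.cap s := by
    refine Finset.sum_le_sum fun s hs => ?_
    have hs1 := Finset.mem_range.mp (Finset.mem_filter.mp hs).1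
    refine le_trans (Finset.card_le_card ?_) (hcap s hs1)
    exact Finset.filter_subset_filter _ (Finset.filter_subset _ _)
  omega

theorem PDInv.lt_of_left_eq_zero (h : PDInv M x a ord par p t spare c 0) :
    ∀ i < M.n, a i < M.m := by
  intro i hi
  rcases (h.le i hi).lt_or_eq with h1 | h1
  · exact h1
  · have h2 : i ∈ (Finset.range M.n).filter fun i => a i = M.m := by simp [hi, h1]
    have h3 := h.left_eq
    unfold load at h3
    rw [eq_comm, Finset.card_eq_zero] at h3
    simp [h3] at h2

theorem PDInv.min_cost (h : PDInv M x a ord par p t spare c 0) {i s : ℕ} (hi : i < M.n)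
    (hs : s < M.m) (hw : M.win i s) : p (a i) + M.w i (a i) ≤ p s + M.w i s := by
  have hai := h.lt_of_left_eq_zero i hi
  rw [← h.tight i hi hai]
  rcases h.slack i hi s hs hw with h1 | h1
  · omega
  · exact h1

/-- The invariant holds for prices `0` and no flight assigned. -/
theorem PDInv.init (M : NumberedMarket K) {a ord : ℕ → ℕ} (par : ℕ → ℕ) {p t spare : ℕ → K}
    (ha : ∀ i < M.n, a i = M.m) (hord : ∀ s < M.m, ord s = 0) (hroot : ord M.m = 1)
    (hp : ∀ s < M.m, p s = 0) (hspare : ∀ s < M.m, spare s = M.cap s) :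
    PDInv M M.m a ord par p t spare 1 M.n := by
  have hload : ∀ s < M.m, load M.n a s = 0 := by
    intro s hs
    unfold load
    rw [Finset.card_eq_zero, Finset.filter_eq_empty_iff]
    intro i hi h1
    rw [ha i (Finset.mem_range.mp hi)] at h1
    omega
  exact
  { le := fun i hi => (ha i hi).le
    win := by intro i hi h1; rw [ha i hi] at h1; omega
    tight := by intro i hi h1; rw [ha i hi] at h1; omega
    load_le := by intro s hs; rw [hload s hs]; omega
    spare_eq := by intro s hs; rw [hload s hs, hspare s hs]; simp
    price_nonneg := fun s hs => (hp s hs).ge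
    free := fun s hs _ => hp s hs
    -- No condition on `t` is needed, by the exceptional alternative.
    slack := fun i hi s _ _ => Or.inl ⟨ha i hi, hord⟩
    tree := by intro s hs h1; rw [hord s hs] at h1; omega
    root := hroot
    ord_le := by intro s hs; rw [hord s hs]; omega
    c_pos := le_rfl
    count := by
      have : (Finset.range M.m).filter (fun s => ord s = 0) = Finset.range M.m := by
        rw [Finset.filter_eq_self]
        intro s hs
        exact hord s (Finset.mem_range.mp hs)
      rw [this, Finset.card_range, add_comm]
    left_eq := by
      unfold load
      rw [Finset.filter_true_of_mem, Finset.card_range]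
      intro i hi
      exact ha i (Finset.mem_range.mp hi)
    full := by intro s hs h1; rw [hord s hs] at h1; omega }

end PrimalDual

/-! ### The program

Index arrays: `0` size of the instance, `1` landing windows, `2` flag, `3` assignment, `4`
numbering of the search tree, `5` parents in the tree, `6`, `7` counters, `8` to `10` a tree
edge of minimum slack, `12` number of slots in the tree, `13` number of unassigned flights,
`14` to `16` temporary variables. Number arrays: `0` prices, `1` costs of the flights, `2`
slack, `3` spare capacities. -/

section Program

def flightCount : IExpr := .get 0 (.const 0) (.const 0)

def slotCount : IExpr := .get 0 (.const 0) (.const 1)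

def initProg : Prog :=
  .seq (forLoop 6 flightCount (.iset 3 (var 6) (.const 0) slotCount)) <|
  .seq (forLoop 7 slotCount (.nset 3 (var 7) (.const 0) (.inp 2 (var 7) (.const 0)))) <|
  .seq (.iset 4 slotCount (.const 0) (.const 1)) <|
  .seq (.iset 12 (.const 0) (.const 0) (.const 1)) <|
  .seq (.iset 13 (.const 0) (.const 0) flightCount) <|
  .iset 2 (.const 0) (.const 0) (.const 1)

/-- Slack of the edge from flight `var 6` to slot `var 7`. -/
def slackExpr : NExpr :=
  .sub (.add (ncell 0 (var 7)) (.prod 0 (var 6) (.const 0) 1 (var 6) (var 7)))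
    (ncell 1 (var 6))

/-- The edge leaves the tree, and its slack is less than that of the edges seen before. -/
def scanTest : Test :=
  .and (.ilt (.const 0) (cell 4 (cell 3 (var 6)))) <|
  .and (.ilt (.const 0) (.get 1 (var 6) (var 7))) <|
  .and (.ilt (cell 4 (var 7)) (.const 1)) <|
  -- A disjunction by De Morgan: either no leaving edge has been found yet, or this one has strictly
  -- smaller slack.
  .neg (.and (.neg (.ilt (var 8) (.const 1))) (.neg (.nlt slackExpr (ncell 2 (.const 0)))))

def scanBody : Prog :=
  .ite scanTest
    (.seq (.nset 2 (.const 0) (.const 0) slackExpr) <|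
      .seq (.iset 8 (.const 0) (.const 0) (.const 1)) <|
      .seq (.iset 9 (.const 0) (.const 0) (var 6)) <|
      .iset 10 (.const 0) (.const 0) (var 7))
    .skip

def scanProg : Prog :=
  .seq (.iset 8 (.const 0) (.const 0) (.const 0)) <|
  forLoop 6 flightCount (forLoop 7 slotCount scanBody)

def raiseProg : Prog :=
  .seq (forLoop 6 flightCount (.ite (.ilt (.const 0) (cell 4 (cell 3 (var 6))))
    (.nset 1 (var 6) (.const 0) (.add (ncell 1 (var 6)) (ncell 2 (.const 0)))) .skip)) <|
  forLoop 7 slotCount (.ite (.ilt (.const 0) (cell 4 (var 7)))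
    (.nset 0 (var 7) (.const 0) (.add (ncell 0 (var 7)) (ncell 2 (.const 0)))) .skip)

def flipBody : Prog :=
  .seq (.iset 16 (.const 0) (.const 0) (cell 5 (var 14))) <|
  -- The old slot of the flight is saved before it is overwritten; it becomes the next slot to fill.
  .seq (.iset 15 (.const 0) (.const 0) (cell 3 (var 16))) <|
  .seq (.iset 3 (var 16) (.const 0) (var 14)) <|
  .iset 14 (.const 0) (.const 0) (var 15)

def flipProg : Prog :=
  .seq (.iset 14 (.const 0) (.const 0) (var 10)) <|
  .seq (.loop (.ilt (var 14) slotCount) flipBody) <|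
  .seq (forLoop 7 slotCount (.iset 4 (var 7) (.const 0) (.const 0))) <|
  .seq (.nset 3 (var 10) (.const 0) (.sub (ncell 3 (var 10)) (.const 1))) <|
  .seq (.iset 12 (.const 0) (.const 0) (.const 1)) <|
  .iset 13 (.const 0) (.const 0) (.sub (var 13) (.const 1))

def stepProg : Prog :=
  .seq scanProg <|
  .ite (.ilt (var 8) (.const 1))
    (.seq (.iset 2 (.const 0) (.const 0) (.const 0)) <|
      -- Setting the number of unassigned flights to `0` serves only to leave the main loop; the
      -- flag records the failure.
      .iset 13 (.const 0) (.const 0) (.const 0))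
    (.seq raiseProg <|
      .seq (.iset 5 (var 10) (.const 0) (var 9)) <|
      .seq (.iset 12 (.const 0) (.const 0) (.add (var 12) (.const 1))) <|
      .seq (.iset 4 (var 10) (.const 0) (var 12)) <|
      .ite (.nlt (.const 0) (ncell 3 (var 10))) flipProg .skip)

def marketProg : Prog :=
  .seq initProg (.loop (.ilt (.const 0) (var 13)) stepProg)

variable {K : Type}

/-- The store holds the size and the landing windows of the market. -/
structure Holds (M : NumberedMarket K) (σ : Store K) : Prop where
  n_eq : σ.idx 0 0 0 = M.n
  m_eq : σ.idx 0 0 1 = M.m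
  win_iff : ∀ i < M.n, ∀ s < M.m, 0 < σ.idx 1 i s ↔ M.win i s

theorem Holds.congr {M : NumberedMarket K} {σ τ : Store K} (h : Holds M σ)
    (h0 : τ.idx 0 = σ.idx 0) (h1 : τ.idx 1 = σ.idx 1) : Holds M τ :=
  ⟨by rw [h0]; exact h.n_eq, by rw [h0]; exact h.m_eq, by rw [h1]; exact h.win_iff⟩

variable [Field K] [LinearOrder K] {M : NumberedMarket K} {N : ℕ} {inp : ℕ → ℕ → ℕ → K}
  {σ : Store K}

/-- The read-only memory holds the numbers of the market. -/
structure InputHolds (M : NumberedMarket K) (inp : ℕ → ℕ → ℕ → K) : Prop where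
  w_eq : ∀ i s, inp 0 i 0 * inp 1 i s = M.w i s
  cap_eq : ∀ s < M.m, inp 2 s 0 = M.cap s

/-- The edge `(i, s)` leaves the search tree. -/
def Leaves (M : NumberedMarket K) (σ : Store K) (i s : ℕ) : Prop :=
  i < M.n ∧ s < M.m ∧ M.win i s ∧ 0 < σ.col 4 (σ.col 3 i) ∧ σ.col 4 s = 0

def slackOf (M : NumberedMarket K) (σ : Store K) (i s : ℕ) : K :=
  σ.ncol 0 s + M.w i s - σ.ncol 1 i

/-- The variables `8`, `9`, `10` of `τ` describe an edge of minimum slack among the edges with the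
property `p` that leave the tree of `σ`. -/
def IsBest (M : NumberedMarket K) (σ : Store K) (p : ℕ → ℕ → Prop) (τ : Store K) : Prop :=
  (τ.col 8 0 = 0 ∧ ∀ i s, Leaves M σ i s → ¬ p i s) ∨
  (τ.col 8 0 = 1 ∧ Leaves M σ (τ.col 9 0) (τ.col 10 0) ∧
    τ.ncol 2 0 = slackOf M σ (τ.col 9 0) (τ.col 10 0) ∧
    ∀ i s, Leaves M σ i s → p i s → τ.ncol 2 0 ≤ slackOf M σ i s)

theorem IsBest.congr {p q : ℕ → ℕ → Prop} {τ : Store K} (h : IsBest M σ p τ)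
    (hpq : ∀ i s, Leaves M σ i s → (q i s ↔ p i s)) : IsBest M σ q τ := by
  rcases h with ⟨h1, h2⟩ | ⟨h1, h2, h3, h4⟩
  · exact Or.inl ⟨h1, fun i s hl hq => h2 i s hl ((hpq i s hl).1 hq)⟩
  · exact Or.inr ⟨h1, h2, h3, fun i s hl hq => h4 i s hl ((hpq i s hl).1 hq)⟩

theorem scanBody_runs (hM : Holds M σ) (hI : InputHolds M inp) {i s : ℕ} (hi : i < M.n)
    (hs : s < M.m) {p : ℕ → ℕ → Prop} {τ : Store K} (h : IsBest M σ p τ)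
    (h6 : τ.col 6 0 = i) (h7 : τ.col 7 0 = s)
    (hidx : ∀ a ∉ [6, 7, 8, 9, 10], τ.idx a = σ.idx a)
    (hnum : ∀ a ∉ [2], τ.num a = σ.num a) :
    Runs N inp scanBody τ (IsBest M σ fun i' s' => p i' s' ∨ (i' = i ∧ s' = s)) := by
  have c1 : τ.idx 1 = σ.idx 1 := hidx 1 (by decide)
  have c3 : τ.col 3 = σ.col 3 := Store.col_eq (hidx 3 (by decide))
  have c4 : τ.col 4 = σ.col 4 := Store.col_eq (hidx 4 (by decide))
  have n0 : τ.ncol 0 = σ.ncol 0 := Store.ncol_eq (hnum 0 (by decide))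
  have n1 : τ.ncol 1 = σ.ncol 1 := Store.ncol_eq (hnum 1 (by decide))
  have hsl : slackExpr.eval inp τ = slackOf M σ i s := by
    simp only [slackExpr, NExpr.eval, eval_ncell, eval_var, eval_const, h6, h7, n0, n1,
      slackOf, hI.w_eq]
  have hT : scanTest.Holds inp τ ↔
      Leaves M σ i s ∧ (τ.col 8 0 = 0 ∨ slackOf M σ i s < τ.ncol 2 0) := by
    simp only [scanTest, Test.Holds, hsl, eval_cell, eval_ncell, eval_var, h6, h7,
      c3, c4, IExpr.eval, c1, hM.win_iff i hi s hs, Leaves, hi, hs, true_and, Nat.lt_one_iff]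
    tauto
  refine Runs.ite (fun hc => ?_) fun hc => Runs.skip ?_
  · rw [hT] at hc
    refine Runs.seq (Runs.nset (Runs.seq (Runs.iset (Runs.seq (Runs.iset (Runs.iset ?_))))))
    right
    rw [hsl]
    simp [Store.col_setIdx_of_ne, h6, h7]
    refine ⟨hc.1, ?_⟩
    rintro i' s' hl (hp | ⟨rfl, rfl⟩)
    · rcases h with ⟨_, h2⟩ | ⟨h1, h2, h3, h4⟩
      · exact absurd hp (h2 _ _ hl)
      · rcases hc.2 with h5 | h5
        · omega
        · exact h5.le.trans (h4 _ _ hl hp)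
    · exact le_rfl
  · rw [hT] at hc
    rcases h with ⟨h1, h2⟩ | ⟨h1, h2, h3, h4⟩
    · refine Or.inl ⟨h1, ?_⟩
      rintro i' s' hl (hp | ⟨rfl, rfl⟩)
      · exact h2 _ _ hl hp
      · exact hc ⟨hl, Or.inl h1⟩
    · refine Or.inr ⟨h1, h2, h3, ?_⟩
      rintro i' s' hl (hp | ⟨rfl, rfl⟩)
      · exact h4 _ _ hl hp
      · exact not_lt.1 fun h5 => hc ⟨hl, Or.inr h5⟩

theorem IsBest.setIdx {p : ℕ → ℕ → Prop} {τ : Store K} (h : IsBest M σ p τ) {a : ℕ}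
    (h8 : 8 ≠ a) (h9 : 9 ≠ a) (h10 : 10 ≠ a) (i j v : ℕ) : IsBest M σ p (τ.setIdx a i j v) := by
  simpa only [IsBest, Store.col_setIdx_of_ne h8, Store.col_setIdx_of_ne h9,
    Store.col_setIdx_of_ne h10, Store.ncol_setIdx] using h

theorem scanProg_runs (hM : Holds M σ) (hI : InputHolds M inp) (hn : M.n ≤ N) (hm : M.m ≤ N) :
    Runs N inp scanProg σ (IsBest M σ fun _ _ => True) := by
  refine Runs.seq (Runs.iset ?_)
  refine (Runs.forLoop (k := M.n) (fun k => IsBest M σ fun i _ => i < k) (by decide) hn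
    (fun k τ x h => h.setIdx (by decide) (by decide) (by decide) _ _ _)
    (Or.inl ⟨by simp, fun _ _ _ => by simp⟩) ?_ ?_).imp fun τ h => h.congr ?_
  · intro τ hτ
    have := hτ 0 (by decide)
    simp only [flightCount, IExpr.eval, this]
    exact hM.n_eq
  · intro i hi τ hτ h6 hidx hnum
    have hidx1 : ∀ a ∉ [6, 7, 8, 9, 10], τ.idx a = σ.idx a := by
      intro a ha
      have ha' : a ∉ 6 :: (forLoop 7 slotCount scanBody).idxWrites := by
        simp only [forLoop, scanBody, Prog.idxWrites, List.mem_cons, List.mem_append] at ha ⊢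
        tauto
      rw [hidx a ha', Store.idx_setIdx_of_ne]
      rintro rfl
      simp at ha
    -- The edges seen so far form an initial segment of the lexicographic order.
    refine (Runs.forLoop (k := M.m) (fun k => IsBest M σ fun i' s' => i' < i ∨ (i' = i ∧ s' < k))
      (by decide) hm
      (fun k τ x h => h.setIdx (by decide) (by decide) (by decide) _ _ _)
      (hτ.congr fun _ _ _ => by simp) ?_ ?_).imp fun ρ h => h.congr ?_
    · intro ρ hρ
      have := hρ 0 (by decide)
      simp only [slotCount, IExpr.eval, this, hidx1 0 (by decide)]
      exact hM.m_eq
    · intro s hs ρ hρ h7 hidx' hnum'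
      have c6 : ρ.col 6 = τ.col 6 := Store.col_eq (hidx' 6 (by decide))
      refine (scanBody_runs hM hI hi hs hρ (by rw [c6]; exact h6) h7 ?_ ?_).imp
        fun π h => h.congr ?_
      · intro a ha
        rw [hidx' a, hidx1 a ha]
        simp only [scanBody, Prog.idxWrites, List.mem_cons, List.mem_append] at ha ⊢
        tauto
      · intro a ha
        rw [hnum' a ha, hnum a ha]
        rfl
      · intro i' s' _; omega
    · intro i' s' hl
      have := hl.2.1
      omega
  · intro i' s' hl
    simp [hl.1]

theorem raiseProg_runs (hM : Holds M σ) (hn : M.n ≤ N) (hm : M.m ≤ N) :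
    Runs N inp raiseProg σ fun τ =>
      (∀ i < M.n, τ.ncol 1 i = if 0 < σ.col 4 (σ.col 3 i) then σ.ncol 1 i + σ.ncol 2 0
        else σ.ncol 1 i) ∧
      (∀ s < M.m, τ.ncol 0 s = if 0 < σ.col 4 s then σ.ncol 0 s + σ.ncol 2 0
        else σ.ncol 0 s) := by
  refine Runs.seq ((Runs.forLoop (k := M.n) (fun k τ => ∀ i, τ.ncol 1 i =
    if i < k ∧ 0 < σ.col 4 (σ.col 3 i) then σ.ncol 1 i + σ.ncol 2 0 else σ.ncol 1 i)
    (by decide) hn (fun k τ x h => h) (by simp) ?_ ?_).frame fun τ hτ hidx hnum => ?_)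
  · intro τ hτ
    simp only [flightCount, IExpr.eval, hτ 0 (by decide)]
    exact hM.n_eq
  · intro k hk τ hτ h6 hidx hnum
    have c3 : τ.col 3 = σ.col 3 := Store.col_eq (hidx 3 (by decide))
    have c4 : τ.col 4 = σ.col 4 := Store.col_eq (hidx 4 (by decide))
    have n2 : τ.ncol 2 = σ.ncol 2 := Store.ncol_eq (hnum 2 (by decide))
    refine Runs.ite (fun hc => Runs.nset fun i => ?_) fun hc => Runs.skip fun i => ?_
    · simp only [Test.Holds, eval_const, eval_cell, eval_var, h6, c3, c4] at hc
      simp only [eval_var, h6, eval_const, Store.ncol_setNum_self, NExpr.eval, eval_ncell, n2]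
      by_cases hik : i = k
      · subst hik
        simp [hτ i, hc]
      · rw [Function.update_of_ne hik, hτ i]
        have : i < k ↔ i < k + 1 := by omega
        simp only [this]
    · simp only [Test.Holds, eval_const, eval_cell, eval_var, h6, c3, c4] at hc
      rw [hτ i]
      by_cases hik : i = k
      · subst hik
        simp [hc]
      · have : i < k ↔ i < k + 1 := by omega
        simp only [this]
  have c4 : τ.col 4 = σ.col 4 := Store.col_eq (hidx 4 (by decide))
  have n0 : τ.ncol 0 = σ.ncol 0 := Store.ncol_eq (hnum 0 (by decide))
  have n2 : τ.ncol 2 = σ.ncol 2 := Store.ncol_eq (hnum 2 (by decide))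
  have i0 := hidx 0 (by decide)
  refine (Runs.forLoop (k := M.m) (fun k τ => ∀ s, τ.ncol 0 s =
    if s < k ∧ 0 < σ.col 4 s then σ.ncol 0 s + σ.ncol 2 0 else σ.ncol 0 s)
    (by decide) hm (fun k τ x h => h) (by simp [n0]) ?_ ?_).frame fun ρ hρ hidx' hnum' => ?_
  · intro ρ hρ
    simp only [slotCount, IExpr.eval, hρ 0 (by decide), i0]
    exact hM.m_eq
  · intro k hk ρ hρ h7 hidx' hnum'
    have c4' : ρ.col 4 = σ.col 4 := (Store.col_eq (hidx' 4 (by decide))).trans c4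
    have n2' : ρ.ncol 2 = σ.ncol 2 := (Store.ncol_eq (hnum' 2 (by decide))).trans n2
    refine Runs.ite (fun hc => Runs.nset fun i => ?_) fun hc => Runs.skip fun i => ?_
    · simp only [Test.Holds, eval_const, eval_cell, eval_var, h7, c4'] at hc
      simp only [eval_var, h7, eval_const, Store.ncol_setNum_self, NExpr.eval, eval_ncell, n2']
      by_cases hik : i = k
      · subst hik
        simp [hρ i, hc]
      · rw [Function.update_of_ne hik, hρ i]
        have : i < k ↔ i < k + 1 := by omega
        simp only [this]
    · simp only [Test.Holds, eval_const, eval_cell, eval_var, h7, c4'] at hc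
      rw [hρ i]
      by_cases hik : i = k
      · subst hik
        simp [hc]
      · have : i < k ↔ i < k + 1 := by omega
        simp only [this]
  · have n1 : ρ.ncol 1 = τ.ncol 1 := Store.ncol_eq (hnum' 1 (by decide))
    refine ⟨fun i hi => ?_, fun s hs => ?_⟩
    · rw [n1, hτ i]; simp [hi]
    · rw [hρ s]; simp [hs]

end Program

/-! ### Termination and correctness of the program on numbered markets -/

section ProgramCorrectness

variable {K : Type} {M : NumberedMarket K} {σ : Store K}

/-- Bound for the number of remaining iterations of the main loop. -/
def mainMeasure (M : NumberedMarket K) (σ : Store K) : ℕ :=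
  σ.col 13 0 * (M.m + 1) + ((Finset.range M.m).filter fun s => σ.col 4 s = 0).card

/-- Resetting the tree adds at most `M.m` to the number of unreached slots, less than the `M.m + 1`
gained by assigning a flight. -/
theorem mainMeasure_lt {τ : Store K} (h : τ.col 13 0 < σ.col 13 0) :
    mainMeasure M τ < mainMeasure M σ := by
  have h1 : ((Finset.range M.m).filter fun s => τ.col 4 s = 0).card ≤ M.m := by
    simpa using Finset.card_filter_le (Finset.range M.m) fun s => τ.col 4 s = 0
  have h2 : (τ.col 13 0 + 1) * (M.m + 1) ≤ σ.col 13 0 * (M.m + 1) := Nat.mul_le_mul_right _ h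
  rw [add_mul, one_mul] at h2
  unfold mainMeasure
  omega

variable [Field K] [LinearOrder K] {N : ℕ} {inp : ℕ → ℕ → ℕ → K}

/-- The invariant of the primal-dual method for the contents of a store. -/
def StoreInv (M : NumberedMarket K) (x : ℕ) (σ : Store K) : Prop :=
  PDInv M x (σ.col 3) (σ.col 4) (σ.col 5) (σ.ncol 0) (σ.ncol 1) (σ.ncol 3) (σ.col 12 0)
    (σ.col 13 0)

theorem flipProg_runs (hM : Holds M σ) (hm : M.m + 1 ≤ N)
    (h : StoreInv M (σ.col 10 0) σ) (hbs : σ.col 10 0 < M.m) (hord : 0 < σ.col 4 (σ.col 10 0))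
    (hlt : load M.n (σ.col 3) (σ.col 10 0) < M.cap (σ.col 10 0)) :
    Runs N inp flipProg σ fun τ => StoreInv M M.m τ ∧ τ.col 13 0 < σ.col 13 0 := by
  refine Runs.seq (Runs.iset (Runs.seq ?_))
  simp only [eval_var, eval_const]
  -- The variant is the tree number of the current slot; it starts at no more than `c`, which is at
  -- most `M.m + 1`.
  refine (Runs.loop (fun τ => FlipInv M (σ.col 10 0) (σ.col 3) (σ.col 4) (σ.col 5) (σ.ncol 0)
    (σ.ncol 1) (τ.col 3) (τ.col 14 0)) (fun τ => σ.col 4 (τ.col 14 0)) ?_ ?_ ?_).frame ?_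
  · simpa [Store.col_setIdx_of_ne] using FlipInv.init h hbs hord
  · simp only [Store.col_setIdx_self, Function.update_self]
    have h1 := h.ord_le _ hbs
    have h2 := h.count
    omega
  · intro τ hτ hc hidx hnum
    have i0 : τ.idx 0 = σ.idx 0 := by
      rw [hidx 0 (by decide), Store.idx_setIdx_of_ne (by decide)]
    have c5 : τ.col 5 = σ.col 5 := by
      rw [Store.col_eq (hidx 5 (by decide)), Store.col_setIdx_of_ne (by decide)]
    have hc' : τ.col 14 0 < M.m := by
      simpa only [Test.Holds, eval_var, slotCount, IExpr.eval, i0, hM.m_eq] using hc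
    refine Runs.seq (Runs.iset (Runs.seq (Runs.iset (Runs.seq (Runs.iset (Runs.iset ?_))))))
    simpa [Store.col_setIdx_of_ne, c5] using hτ.step hc'
  · intro τ ⟨hτ, hc⟩ hidx hnum
    have i0 : τ.idx 0 = σ.idx 0 := by
      rw [hidx 0 (by decide), Store.idx_setIdx_of_ne (by decide)]
    have hc' : ¬ τ.col 14 0 < M.m := by
      simpa only [Test.Holds, eval_var, slotCount, IExpr.eval, i0, hM.m_eq] using hc
    have hcur : τ.col 14 0 = M.m := by have := hτ.cur_le; omega
    rw [hcur] at hτ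
    have c4 : τ.col 4 = σ.col 4 := by
      rw [Store.col_eq (hidx 4 (by decide)), Store.col_setIdx_of_ne (by decide)]
    -- The second clause is needed at `M.m`: the reset must leave the number `1` of the root intact.
    refine Runs.seq ((Runs.forLoop (k := M.m) (fun k ρ => (∀ s < k, ρ.col 4 s = 0) ∧
      ∀ s, k ≤ s → ρ.col 4 s = σ.col 4 s) (by decide) (by omega) ?_ ?_ ?_ ?_).frame ?_)
    · intro k ρ x hρ
      simpa only [Store.col_setIdx_of_ne (show 4 ≠ 7 by decide)] using hρ
    · exact ⟨by simp, fun s _ => by rw [c4]⟩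
    · intro ρ hρ
      simp only [slotCount, IExpr.eval, hρ 0 (by decide), i0]
      exact hM.m_eq
    · intro k hk ρ hρ h7 _ _
      refine Runs.iset ?_
      simp only [eval_var, h7, eval_const, Store.col_setIdx_self]
      refine ⟨fun s hs => ?_, fun s hs => ?_⟩
      · by_cases hsk : s = k
        · simp [hsk]
        · rw [Function.update_of_ne hsk]; exact hρ.1 s (by omega)
      · rw [Function.update_of_ne (by omega)]; exact hρ.2 s (by omega)
    · intro ρ hρ hidx' hnum'
      refine Runs.seq (Runs.nset (Runs.seq (Runs.iset (Runs.iset ?_))))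
      have e3 : ρ.col 3 = τ.col 3 := Store.col_eq (hidx' 3 (by decide))
      have e : ∀ a ∉ [3, 4, 7, 14, 15, 16], ρ.col a = σ.col a := by
        intro a ha
        rw [Store.col_eq (hidx' a _), Store.col_eq (hidx a _), Store.col_setIdx_of_ne]
        · rintro rfl; simp at ha
        · simp only [flipBody, Prog.idxWrites, List.mem_cons, List.mem_append] at ha ⊢
          tauto
        · simp only [forLoop, Prog.idxWrites, List.mem_cons, List.mem_append] at ha ⊢
          tauto
      have en : ∀ a, ρ.ncol a = σ.ncol a := fun a =>
        (Store.ncol_eq (hnum' a (by simp [forLoop, Prog.numWrites]))).trans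
          (Store.ncol_eq (hnum a (by simp [flipBody, Prog.numWrites])))
      obtain ⟨f1, f2⟩ := hτ.finish h hbs hord hlt (ord' := ρ.col 4) hρ.1
        (by rw [hρ.2 _ le_rfl]; exact h.root)
      simp only [StoreInv, eval_var, IExpr.eval, NExpr.eval, eval_ncell,
        Store.col_setIdx_self, Store.col_setNum, Store.ncol_setIdx, Store.ncol_setNum_self,
        Function.update_self, ne_eq, Nat.reduceEqDiff, not_false_eq_true,
        Store.col_setIdx_of_ne, Store.ncol_setNum_of_ne, OfNat.zero_ne_ofNat,
        OfNat.one_ne_ofNat, e3, en, e 5 (by decide), e 10 (by decide), e 13 (by decide),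
        Nat.cast_one]
      refine ⟨?_, by omega⟩
      convert f2 using 1

/-- Invariant of the main loop. -/
def MainInv (M : NumberedMarket K) (σ : Store K) : Prop :=
  (σ.col 2 0 = 1 ∧ StoreInv M M.m σ) ∨
    (σ.col 2 0 = 0 ∧ σ.col 13 0 = 0 ∧ ∀ b, ¬ M.IsSchedule b)

theorem stepProg_runs [IsStrictOrderedRing K] (hM : Holds M σ) (hI : InputHolds M inp)
    (hn : M.n ≤ N) (hm : M.m + 1 ≤ N) (h : MainInv M σ) (hleft : 0 < σ.col 13 0) :
    Runs N inp stepProg σ fun τ => MainInv M τ ∧ mainMeasure M τ < mainMeasure M σ := by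
  obtain ⟨hflag, h⟩ : σ.col 2 0 = 1 ∧ StoreInv M M.m σ := by
    rcases h with h | ⟨_, h, _⟩
    · exact h
    · omega
  refine Runs.seq ((scanProg_runs hM hI hn (by omega)).frame fun τ hτ hidx hnum => ?_)
  have e : ∀ a ∉ [6, 7, 8, 9, 10], τ.idx a = σ.idx a := by
    intro a ha
    apply hidx
    simp only [scanProg, scanBody, forLoop, Prog.idxWrites, List.mem_cons, List.mem_append]
      at ha ⊢
    tauto
  have c : ∀ a ∉ [6, 7, 8, 9, 10], τ.col a = σ.col a := fun a ha => Store.col_eq (e a ha)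
  have n : ∀ a ≠ 2, τ.ncol a = σ.ncol a := fun a ha => Store.ncol_eq
    (hnum a (by simpa [scanProg, scanBody, forLoop, Prog.numWrites] using ha))
  refine Runs.ite (fun hc => ?_) fun hc => ?_
  · have h8 : τ.col 8 0 = 0 := by simpa [Test.Holds] using hc
    have hstuck : ∀ i s, ¬ Leaves M σ i s := by
      rcases hτ with ⟨_, h2⟩ | ⟨h1, _⟩
      · exact fun i s hl => h2 i s hl trivial
      · omega
    refine Runs.seq (Runs.iset (Runs.iset ⟨Or.inr ?_, mainMeasure_lt ?_⟩))
    · refine ⟨by simp [Store.col_setIdx_of_ne], by simp, h.infeasible hleft ?_⟩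
      intro i hi s hs hw hT
      by_contra hos
      exact hstuck i s ⟨hi, hs, hw, hT, by omega⟩
    · simpa using hleft
  have h8 : ¬ τ.col 8 0 = 0 := by simpa [Test.Holds] using hc
  obtain ⟨⟨hbi, hbs, hw, hT, hnT⟩, hδ, hmin⟩ : Leaves M σ (τ.col 9 0) (τ.col 10 0) ∧
      τ.ncol 2 0 = slackOf M σ (τ.col 9 0) (τ.col 10 0) ∧
      ∀ i s, Leaves M σ i s → τ.ncol 2 0 ≤ slackOf M σ i s := by
    rcases hτ with ⟨h1, _⟩ | ⟨_, h2, h3, h4⟩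
    · exact absurd h1 h8
    · exact ⟨h2, h3, fun i s hl => h4 i s hl trivial⟩
  have hMτ : Holds M τ := hM.congr (e 0 (by decide)) (e 1 (by decide))
  refine Runs.seq ((raiseProg_runs hMτ hn (by omega)).frame fun ρ hρ hidx' hnum' => ?_)
  have e' : ∀ a ∉ [6, 7], ρ.idx a = τ.idx a := by
    intro a ha
    apply hidx'
    simp only [raiseProg, forLoop, Prog.idxWrites, List.mem_cons, List.mem_append] at ha ⊢
    tauto
  have c' : ∀ a ∉ [6, 7, 8, 9, 10], ρ.col a = σ.col a := by
    intro a ha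
    rw [← c a ha]
    refine Store.col_eq (e' a ?_)
    simp only [List.mem_cons] at ha ⊢
    tauto
  have n3 : ρ.ncol 3 = σ.ncol 3 :=
    (Store.ncol_eq (hnum' 3 (by decide))).trans (n 3 (by decide))
  have c9 : ρ.col 9 = τ.col 9 := Store.col_eq (e' 9 (by decide))
  have c10 : ρ.col 10 = τ.col 10 := Store.col_eq (e' 10 (by decide))
  simp only [c 3 (by decide), c 4 (by decide), n 1 (by decide), n 0 (by decide)] at hρ
  have hgrow := PDInv.grow h hbi hbs hw hT hnT hδ
    (fun i hi s hs hw hT hnT => hmin i s ⟨hi, hs, hw, hT, hnT⟩) hρ.2 hρ.1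
  refine Runs.seq (Runs.iset (Runs.seq (Runs.iset (Runs.seq (Runs.iset ?_)))))
  simp only [eval_var, IExpr.eval, Store.col_setIdx_self, Function.update_self,
    Store.col_setIdx_of_ne, ne_eq, Nat.reduceEqDiff, not_false_eq_true, c9, c10,
    c' 12 (by decide)]
  set π := ((ρ.setIdx 5 (τ.col 10 0) 0 (τ.col 9 0)).setIdx 12 0 0 (σ.col 12 0 + 1)).setIdx 4
    (τ.col 10 0) 0 (σ.col 12 0 + 1) with hπ
  have p3 : π.col 3 = σ.col 3 := by
    simp [hπ, Store.col_setIdx_of_ne, c' 3 (by decide)]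
  have p4 : π.col 4 = Function.update (σ.col 4) (τ.col 10 0) (σ.col 12 0 + 1) := by
    simp [hπ, Store.col_setIdx_of_ne, c' 4 (by decide)]
  have p5 : π.col 5 = Function.update (σ.col 5) (τ.col 10 0) (τ.col 9 0) := by
    simp [hπ, Store.col_setIdx_of_ne, c' 5 (by decide)]
  have p12 : π.col 12 0 = σ.col 12 0 + 1 := by
    simp [hπ, Store.col_setIdx_of_ne]
  have p13 : π.col 13 0 = σ.col 13 0 := by
    simp [hπ, Store.col_setIdx_of_ne, c' 13 (by decide)]
  have p10 : π.col 10 0 = τ.col 10 0 := by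
    simp [hπ, Store.col_setIdx_of_ne, c10]
  have p2 : π.col 2 0 = σ.col 2 0 := by
    simp [hπ, Store.col_setIdx_of_ne, c' 2 (by decide)]
  have q : ∀ a, π.ncol a = ρ.ncol a := fun a => rfl
  have hinv : StoreInv M (τ.col 10 0) π := by
    unfold StoreInv
    rwa [p3, p4, p5, p12, p13, q, q, q, n3]
  have hMπ : Holds M π := by
    have i0 : π.idx 0 = ρ.idx 0 := by simp [hπ, Store.idx_setIdx_of_ne]
    have i1 : π.idx 1 = ρ.idx 1 := by simp [hπ, Store.idx_setIdx_of_ne]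
    exact hMτ.congr (i0.trans (e' 0 (by decide))) (i1.trans (e' 1 (by decide)))
  have hspare : 0 < π.ncol 3 (τ.col 10 0) ↔
      load M.n (π.col 3) (τ.col 10 0) < M.cap (τ.col 10 0) := by
    rw [hinv.spare_eq _ hbs, sub_pos, Nat.cast_lt]
  have htest : (Test.nlt (.const 0) (ncell 3 (var 10))).Holds inp π ↔
      load M.n (π.col 3) (τ.col 10 0) < M.cap (τ.col 10 0) := by
    rw [← hspare]
    simp [Test.Holds, NExpr.eval, p10]
  refine Runs.ite (fun hc => ?_) fun hc => Runs.skip ?_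
  · rw [htest] at hc
    refine (flipProg_runs hMπ hm (by rwa [p10]) (by rwa [p10]) (by simp [p10, p4])
      (by rwa [p10])).frame fun ζ hζ hidx'' _ => ⟨Or.inl ⟨?_, hζ.1⟩, mainMeasure_lt ?_⟩
    · rw [Store.col_eq (hidx'' 2 (by decide)), p2, hflag]
    · rw [← p13]; exact hζ.2
  · rw [htest, not_lt] at hc
    refine ⟨Or.inl ⟨by rw [p2, hflag], hinv.of_filled hc⟩, ?_⟩
    -- The tree gained a slot while the number of unassigned flights is unchanged, so the count of
    -- unreached slots dropped by one.
    have h1 := h.count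
    have h2 := hinv.count
    rw [p12] at h2
    unfold mainMeasure
    rw [p13]
    omega

theorem initProg_runs (hM : Holds M σ) (hI : InputHolds M inp) (hn : M.n ≤ N) (hm : M.m ≤ N)
    (h4 : ∀ s, σ.col 4 s = 0) (h0 : ∀ s, σ.ncol 0 s = 0) :
    Runs N inp initProg σ fun τ => MainInv M τ ∧ τ.col 13 0 = M.n := by
  refine Runs.seq ((Runs.forLoop (k := M.n) (fun k τ => ∀ i < k, τ.col 3 i = M.m) (by decide) hn
    ?_ (by simp) ?_ ?_).frame fun τ hτ hidx hnum => Runs.seq ?_)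
  · intro k τ x hτ
    simpa only [Store.col_setIdx_of_ne (show 3 ≠ 6 by decide)] using hτ
  · intro τ hτ
    simp only [flightCount, IExpr.eval, hτ 0 (by decide)]
    exact hM.n_eq
  · intro k hk τ hτ h6 hidx hnum
    refine Runs.iset fun i hi => ?_
    simp only [eval_var, h6, eval_const, Store.col_setIdx_self]
    by_cases hik : i = k
    · subst hik
      simp only [Function.update_self, slotCount, IExpr.eval, hidx 0 (by decide)]
      exact hM.m_eq
    · rw [Function.update_of_ne hik]; exact hτ i (by omega)
  have hMτ : Holds M τ := hM.congr (hidx 0 (by decide)) (hidx 1 (by decide))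
  refine (Runs.forLoop (k := M.m) (fun k ρ => ∀ s < k, ρ.ncol 3 s = (M.cap s : K)) (by decide) hm
    (fun k τ x h => h) (by simp) ?_ ?_).frame fun ρ hρ hidx' hnum' => ?_
  · intro ρ hρ
    simp only [slotCount, IExpr.eval, hρ 0 (by decide)]
    exact hMτ.m_eq
  · intro k hk ρ hρ h7 _ _
    refine Runs.nset fun i hi => ?_
    simp only [eval_var, h7, eval_const, Store.ncol_setNum_self, NExpr.eval]
    by_cases hik : i = k
    · subst hik
      simp only [Function.update_self]
      exact hI.cap_eq i hk
    · rw [Function.update_of_ne hik]; exact hρ i (by omega)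
  have hMρ : Holds M ρ := hMτ.congr (hidx' 0 (by decide)) (hidx' 1 (by decide))
  have c3 : ρ.col 3 = τ.col 3 := Store.col_eq (hidx' 3 (by decide))
  have c4 : ρ.col 4 = σ.col 4 :=
    (Store.col_eq (hidx' 4 (by decide))).trans (Store.col_eq (hidx 4 (by decide)))
  have n0 : ρ.ncol 0 = σ.ncol 0 :=
    (Store.ncol_eq (hnum' 0 (by decide))).trans (Store.ncol_eq (hnum 0 (by decide)))
  have hslot : slotCount.eval ρ = M.m := hMρ.m_eq
  have hflight : ρ.idx 0 0 0 = M.n := hMρ.n_eq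
  refine Runs.seq (Runs.iset (Runs.seq (Runs.iset (Runs.seq (Runs.iset (Runs.iset ?_))))))
  have hfinal := PDInv.init M (a := τ.col 3) (ord := Function.update (σ.col 4) M.m 1)
    (ρ.col 5) (p := σ.ncol 0) (t := ρ.ncol 1) (spare := ρ.ncol 3) hτ
    (fun s hs => by rw [Function.update_of_ne hs.ne]; exact h4 s) (by simp)
    (fun s _ => h0 s) hρ
  refine ⟨Or.inl ⟨by simp, ?_⟩, ?_⟩
  · simpa [StoreInv, Store.col_setIdx_of_ne, hslot, flightCount, IExpr.eval,
      Store.idx_setIdx_of_ne, hflight, c3, c4, n0] using hfinal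
  · simp [Store.col_setIdx_of_ne, flightCount, IExpr.eval, Store.idx_setIdx_of_ne, hflight]

/-- The program finds an equilibrium or recognizes that there is no schedule. -/
theorem marketProg_runs [IsStrictOrderedRing K] (hM : Holds M σ) (hI : InputHolds M inp)
    (hN : (M.n + 1) * (M.m + 1) ≤ N) (h4 : ∀ s, σ.col 4 s = 0) (h0 : ∀ s, σ.ncol 0 s = 0) :
    Runs N inp marketProg σ fun τ => MainInv M τ ∧ τ.col 13 0 = 0 := by
  have hn : M.n ≤ N := by nlinarith
  have hm : M.m + 1 ≤ N := by nlinarith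
  refine Runs.seq ((initProg_runs hM hI hn (by omega) h4 h0).frame fun τ hτ hidx _ => ?_)
  have hMτ : Holds M τ := hM.congr (hidx 0 (by decide)) (hidx 1 (by decide))
  refine (Runs.loop (MainInv M) (mainMeasure M) hτ.1 ?_ ?_).imp ?_
  · have h1 : ((Finset.range M.m).filter fun s => τ.col 4 s = 0).card ≤ M.m := by
      simpa using Finset.card_filter_le (Finset.range M.m) fun s => τ.col 4 s = 0
    rw [add_mul, one_mul] at hN
    unfold mainMeasure
    rw [hτ.2]
    omega
  · intro ρ hρ hc hidx' _
    exact stepProg_runs (hMτ.congr (hidx' 0 (by decide)) (hidx' 1 (by decide))) hI hn hm hρ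
      (by simpa [Test.Holds] using hc)
  · intro ρ ⟨h1, h2⟩
    exact ⟨h1, by simpa [Test.Holds] using h2⟩

end ProgramCorrectness

/-! ### From numbered markets back to markets on `Fin n` and `Fin m` -/

section MarketAlgorithm

variable {K : Type} [Field K] {n m : ℕ}

/-- The market with flights and slots indexed by natural numbers. -/
def Market.numbered (M : Market K (Fin n) (Fin m)) : NumberedMarket K where
  n := n
  m := m
  win i s := ∃ (hi : i < n) (hs : s < m), (⟨s, hs⟩ : Fin m) ∈ M.window ⟨i, hi⟩
  w i s := M.inputNum 0 i 0 * M.inputNum 1 i s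
  cap s := if h : s < m then M.cap ⟨s, h⟩ else 0

/-- The window hypothesis is essential, since the input memory holds `0` for delays outside the
windows. -/
theorem Market.numbered_w (M : Market K (Fin n) (Fin m)) (i : Fin n) {s : Fin m}
    (h : s ∈ M.window i) : M.numbered.w i s = M.crit i * M.delay i s := by
  simp [Market.numbered, Market.inputNum, h]

theorem Market.numbered_cap (M : Market K (Fin n) (Fin m)) (s : Fin m) :
    M.numbered.cap s = M.cap s := by
  simp [Market.numbered]

theorem Market.numbered_win (M : Market K (Fin n) (Fin m)) (i : Fin n) (s : Fin m) :
    M.numbered.win i s ↔ s ∈ M.window i := by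
  simp [Market.numbered]

theorem Market.holds_initStore (M : Market K (Fin n) (Fin m)) :
    Holds M.numbered M.initStore where
  n_eq := by simp [Market.initStore, Market.numbered]
  m_eq := by simp [Market.initStore, Market.numbered]
  win_iff := by
    intro i hi s hs
    have hi : i < n := hi
    have hs : s < m := hs
    simp only [Market.initStore, Market.numbered, hi, hs]
    by_cases h : (⟨s, hs⟩ : Fin m) ∈ M.window ⟨i, hi⟩ <;> simp [h]

theorem Market.inputHolds (M : Market K (Fin n) (Fin m)) :
    InputHolds M.numbered M.inputNum where
  w_eq _ _ := rfl
  cap_eq := by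
    intro s hs
    have hs : s < m := hs
    simp [Market.inputNum, Market.numbered, hs]

theorem card_filter_eq_load {a : Fin n → Fin m} {b : ℕ → ℕ} (h : ∀ i : Fin n, b i = a i)
    (s : Fin m) : (Finset.univ.filter fun i => a i = s).card = load n b s := by
  unfold load
  rw [Finset.card_filter, Finset.card_filter,
    Finset.sum_range fun i => if b i = (s : ℕ) then 1 else 0]
  refine Finset.sum_congr rfl fun i _ => ?_
  simp [h i, Fin.ext_iff]

variable [LinearOrder K]

theorem MainInv.isCorrectOutput {M : Market K (Fin n) (Fin m)} {τ : Store K}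
    (h : MainInv M.numbered τ) (hleft : τ.col 13 0 = 0) : M.IsCorrectOutput τ := by
  rcases h with ⟨hflag, h⟩ | ⟨hflag, _, h⟩
  · have h : PDInv M.numbered m (τ.col 3) (τ.col 4) (τ.col 5) (τ.ncol 0) (τ.ncol 1) (τ.ncol 3)
        (τ.col 12 0) 0 := by
      have h' := h
      unfold StoreInv at h'
      rwa [hleft] at h'
    have hlt : ∀ i : Fin n, τ.col 3 i < m := fun i => h.lt_of_left_eq_zero i i.2
    have hload := card_filter_eq_load (a := fun i : Fin n => (⟨τ.col 3 i, hlt i⟩ : Fin m))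
      (b := τ.col 3) fun i => rfl
    have hwin : ∀ i : Fin n, (⟨τ.col 3 i, hlt i⟩ : Fin m) ∈ M.window i := fun i =>
      (M.numbered_win i ⟨τ.col 3 i, hlt i⟩).1 (h.win i i.2 (hlt i))
    refine Or.inl ⟨hflag, fun i => ⟨τ.col 3 i, hlt i⟩, fun i => rfl, ⟨hwin, fun s => ?_⟩,
      fun s => h.price_nonneg s s.2, fun i s hs => ?_, fun s hs => ?_⟩
    · rw [hload s, ← M.numbered_cap s]
      exact h.load_le s s.2
    · have h1 := h.min_cost i.2 s.2 ((M.numbered_win i s).2 hs)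
      rw [M.numbered_w i hs] at h1
      have h2 := M.numbered_w i (hwin i)
      simp only at h2
      rw [h2] at h1
      exact h1
    · rw [hload s, ← M.numbered_cap s] at hs
      exact h.free s s.2 hs
  · refine Or.inr ⟨hflag, ?_⟩
    rintro ⟨a, ha1, ha2⟩
    have hb : ∀ i : Fin n, (fun i => if h : i < n then (a ⟨i, h⟩ : ℕ) else m) (i : ℕ) = a i := by
      intro i; simp
    -- The value `m` for `i ≥ n` is a dummy: schedules and loads look only at indices below `n`.
    refine h (fun i => if h : i < n then (a ⟨i, h⟩ : ℕ) else m) ⟨fun i hi => ?_, fun s hs => ?_⟩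
    · have hi : i < n := hi
      simp only [hi, dif_pos]
      exact ⟨(a ⟨i, hi⟩).2, (M.numbered_win ⟨i, hi⟩ _).2 (ha1 ⟨i, hi⟩)⟩
    · have h1 := ha2 ⟨s, hs⟩
      rw [card_filter_eq_load (b := fun i => if h : i < n then (a ⟨i, h⟩ : ℕ) else m) hb ⟨s, hs⟩,
        ← M.numbered_cap] at h1
      exact h1

theorem marketProg_correct [IsStrictOrderedRing K] (M : Market K (Fin n) (Fin m)) :
    ∃ (t : ℕ) (τ : Store K), Exec (unitCost K) M.inputNum marketProg M.initStore t τ ∧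
      t ≤ (marketProg.timePoly.comp ((Polynomial.X + 1) ^ 2)).eval (n + m) ∧
      M.IsCorrectOutput τ := by
  -- The main measure starts at most at `n * (m + 1) + m`, and all other loops are shorter than `(n
  -- + 1) * (m + 1)`.
  have hN : (n + 1) * (m + 1) ≤ (n + m + 1) ^ 2 := by nlinarith
  obtain ⟨t, τ, h1, h2, h3, h4⟩ := marketProg_runs M.holds_initStore M.inputHolds hN
    (fun s => by simp [Store.col, Market.initStore])
    (fun s => by simp [Store.ncol, Market.initStore])
  exact ⟨t, τ, h1, by simpa using h2, h3.isCorrectOutput h4⟩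

end MarketAlgorithm

/-! ### Bit length of the input and the polynomial bit bound -/

section BitLength

theorem FracBound.mul {D D' L L' : ℕ} {x y : ℚ} (hx : FracBound D L x)
    (hy : FracBound D' L' y) : FracBound (D * D') (L + L') (x * y) := by
  obtain ⟨z, hz, hb⟩ := hx
  obtain ⟨z', hz', hb'⟩ := hy
  refine ⟨z * z', by push_cast; rw [← hz, ← hz']; ring, ?_⟩
  rw [abs_mul, pow_add]
  exact mul_le_mul hb hb' (abs_nonneg _) (by positivity)

theorem FracBound.natCast {D L L' k : ℕ} (hk : k ≤ 2 ^ L) (hD : D ≤ 2 ^ L') :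
    FracBound D (L + L') (k : ℚ) := by
  refine ⟨(k * D : ℕ), by push_cast; rfl, ?_⟩
  rw [Nat.abs_cast, pow_add]
  exact_mod_cast Nat.mul_le_mul hk hD

theorem FracBound.of_den_dvd {D L L' : ℕ} {x : ℚ} (hden : x.den ∣ D)
    (hnum : x.num.natAbs ≤ 2 ^ L) (hD : D ≤ 2 ^ L') : FracBound D (L + L') x := by
  obtain ⟨e, rfl⟩ := hden
  refine ⟨x.num * e, ?_, ?_⟩
  · push_cast
    rw [← mul_assoc, Rat.mul_den_eq_num]
  · rw [abs_mul, pow_add, Nat.abs_cast, Int.abs_eq_natAbs]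
    have he : e ≤ 2 ^ L' := (Nat.le_mul_of_pos_left e x.den_pos).trans hD
    exact_mod_cast Nat.mul_le_mul hnum he

theorem prod_le_two_pow_sum {ι : Type*} (S : Finset ι) (f g : ι → ℕ)
    (h : ∀ i ∈ S, f i ≤ 2 ^ g i) : ∏ i ∈ S, f i ≤ 2 ^ ∑ i ∈ S, g i := by
  rw [← Finset.prod_pow_eq_pow_sum]
  exact Finset.prod_le_prod' h

theorem num_le_two_pow_bitSize (x : ℚ) : x.num.natAbs ≤ 2 ^ bitSize x :=
  (Nat.lt_size_self _).le.trans (Nat.pow_le_pow_right (by norm_num) (by unfold bitSize; omega))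

theorem den_le_two_pow_bitSize (x : ℚ) : x.den ≤ 2 ^ bitSize x :=
  (Nat.lt_size_self _).le.trans (Nat.pow_le_pow_right (by norm_num) (by unfold bitSize; omega))

variable {n m : ℕ} (M : Market ℚ (Fin n) (Fin m))

/-- A common denominator of the input. -/
def Market.commonDen : ℕ :=
  (∏ i, (M.crit i).den) * ∏ i, ∏ s ∈ M.window i, (M.delay i s).den

theorem Market.commonDen_pos : 0 < M.commonDen := by
  unfold Market.commonDen
  exact Nat.mul_pos (Finset.prod_pos fun i _ => Rat.den_pos _)
    (Finset.prod_pos fun i _ => Finset.prod_pos fun s _ => Rat.den_pos _)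

theorem Market.commonDen_le : M.commonDen ≤ 2 ^ M.bitLength := by
  have h1 := prod_le_two_pow_sum Finset.univ (fun i => (M.crit i).den)
    (fun i => bitSize (M.crit i)) fun i _ => den_le_two_pow_bitSize _
  have h2 := prod_le_two_pow_sum Finset.univ (fun i => ∏ s ∈ M.window i, (M.delay i s).den)
    (fun i => ∑ s ∈ M.window i, bitSize (M.delay i s)) fun i _ =>
      prod_le_two_pow_sum _ _ _ fun s _ => den_le_two_pow_bitSize _
  refine (Nat.mul_le_mul h1 h2).trans ?_
  rw [← pow_add]
  exact Nat.pow_le_pow_right (by norm_num) (by unfold Market.bitLength; omega)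

theorem Market.bitSize_crit_le (i : Fin n) : bitSize (M.crit i) ≤ M.bitLength := by
  have := Finset.single_le_sum (f := fun i => bitSize (M.crit i)) (fun _ _ => Nat.zero_le _)
    (Finset.mem_univ i)
  unfold Market.bitLength
  omega

theorem Market.bitSize_delay_le (i : Fin n) {s : Fin m} (hs : s ∈ M.window i) :
    bitSize (M.delay i s) ≤ M.bitLength := by
  have h1 := Finset.single_le_sum (f := fun s => bitSize (M.delay i s))
    (fun _ _ => Nat.zero_le _) hs
  have h2 := Finset.single_le_sum (f := fun i => ∑ s ∈ M.window i, bitSize (M.delay i s))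
    (fun _ _ => Nat.zero_le _) (Finset.mem_univ i)
  unfold Market.bitLength
  omega

theorem Market.size_cap_le (s : Fin m) : (M.cap s).size ≤ M.bitLength := by
  have := Finset.single_le_sum (f := fun s => (M.cap s).size) (fun _ _ => Nat.zero_le _)
    (Finset.mem_univ s)
  unfold Market.bitLength
  omega

theorem Market.inputNum_den_dvd (a i j : ℕ) : (M.inputNum a i j).den ∣ M.commonDen := by
  unfold Market.inputNum Market.commonDen
  split_ifs with _ h _ h h' _ h
  · exact Dvd.dvd.mul_right
      (Finset.dvd_prod_of_mem (fun i => (M.crit i).den) (Finset.mem_univ _)) _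
  · simp
  · refine Dvd.dvd.mul_left ?_ _
    exact (Finset.dvd_prod_of_mem (fun s => (M.delay ⟨i, h.1⟩ s).den) h').trans
      (Finset.dvd_prod_of_mem (fun i => ∏ s ∈ M.window i, (M.delay i s).den)
        (Finset.mem_univ _))
  all_goals simp

theorem Market.inputNum_num_le (a i j : ℕ) :
    (M.inputNum a i j).num.natAbs ≤ 2 ^ M.bitLength := by
  unfold Market.inputNum
  split_ifs with _ h _ h h' _ h
  · exact le_two_pow_trans (num_le_two_pow_bitSize _) (M.bitSize_crit_le _)
  · simp
  · exact le_two_pow_trans (num_le_two_pow_bitSize _) (M.bitSize_delay_le _ h')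
  · simp
  · simp
  · simpa using le_two_pow_trans (Nat.lt_size_self _).le (M.size_cap_le ⟨i, h.1⟩)
  all_goals simp

/-- The squared common denominator accommodates products of two inputs. Over the simple one, inputs
have numerators of `2 * M.bitLength` bits, so products need `4 * M.bitLength`; the summand `C` pays
for literals. -/
theorem Market.inputBound (C : ℕ) : InputBound (M.commonDen * M.commonDen)
    (C + 4 * M.bitLength) C M.inputNum := by
  have hinp : ∀ a i j, FracBound M.commonDen (M.bitLength + M.bitLength) (M.inputNum a i j) :=
    fun a i j => .of_den_dvd (M.inputNum_den_dvd a i j) (M.inputNum_num_le a i j) M.commonDen_le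
  -- Multiplying by `1`, written over the common denominator, expands inputs and literals to the
  -- squared denominator.
  have hone : FracBound M.commonDen (0 + M.bitLength) 1 := by
    simpa using FracBound.natCast (k := 1) (L := 0) le_rfl M.commonDen_le
  refine ⟨Nat.mul_pos M.commonDen_pos M.commonDen_pos, fun k hk => ?_, ?_, fun a i j => ?_,
    fun a i j b k l => ((hinp a i j).mul (hinp b k l)).mono (by omega)⟩
  · have h1 := (FracBound.natCast (hk.trans Nat.lt_two_pow_self.le) M.commonDen_le).mul hone
    rw [mul_one] at h1
    exact h1.mono (by omega)
  · exact le_two_pow_trans Nat.lt_two_pow_self.le (by omega)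
  · have h1 := (hinp a i j).mul hone
    rw [mul_one] at h1
    exact h1.mono (by omega)

theorem Market.storeBound (D : ℕ) : StoreBound D M.bitLength M.initStore := by
  have hbl : n + m ≤ M.bitLength := by unfold Market.bitLength; omega
  have hlt : M.bitLength < 2 ^ M.bitLength := Nat.lt_two_pow_self
  refine ⟨fun a i j => ?_, fun a i j => ⟨0, by simp [Market.initStore], by simp⟩⟩
  simp only [Market.initStore]
  split_ifs <;> omega

theorem polynomial_eval_mono (q : Polynomial ℕ) {a b : ℕ} (h : a ≤ b) : q.eval a ≤ q.eval b := by
  rw [Polynomial.eval_eq_sum_range, Polynomial.eval_eq_sum_range]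
  gcongr

theorem marketProg_isStronglyPolynomial : IsStronglyPolynomialMarketAlgorithm marketProg := by
  refine ⟨⟨_, fun K _ _ _ n m M => marketProg_correct M⟩, ?_⟩
  set q := marketProg.timePoly.comp ((Polynomial.X + 1) ^ 2) with hq
  set C := marketProg.constSum with hC
  -- At most `q` operations, each on `B + D.size + 2` bits, where `B` is `C + 4 * M.bitLength + t`
  -- and `D.size` is at most `2 * M.bitLength + 1`.
  refine ⟨q * (6 * Polynomial.X + q + ((C + 3 : ℕ) : Polynomial ℕ)), fun n m M => ?_⟩
  obtain ⟨t, τ, h1, h2, h3⟩ := marketProg_correct M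
  have hbl : n + m ≤ M.bitLength := by unfold Market.bitLength; omega
  have ht : t ≤ q.eval M.bitLength := h2.trans (polynomial_eval_mono _ hbl)
  obtain ⟨_, t', h4, h5⟩ := h1.bit_of_unit (N := C) le_rfl (M.inputBound C)
    ((M.storeBound _).mono (by omega)) le_rfl
  refine ⟨t', τ, h4, h5.trans ?_, h3⟩
  have hsize : (M.commonDen * M.commonDen).size ≤ M.bitLength + M.bitLength + 1 :=
    size_le_of_le_two_pow (by
      rw [pow_add]; exact Nat.mul_le_mul M.commonDen_le M.commonDen_le)
  have heval : (q * (6 * Polynomial.X + q + ((C + 3 : ℕ) : Polynomial ℕ))).eval M.bitLength =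
      q.eval M.bitLength * (6 * M.bitLength + q.eval M.bitLength + (C + 3)) := by
    simp
  rw [heval]
  exact Nat.mul_le_mul ht (by omega)

end BitLength

/-! ### Weak duality and complementary slackness for perfect `b`-matchings -/

section Matching

variable {K U V : Type} [Field K] [Fintype U] [Fintype V]

/-- The duality gap is the sum of the slacks of the edges of the matching. -/
theorem WBipartite.totalWeight_sub_dualValue {G : WBipartite K U V} {bU : U → ℤ} {bV : V → ℤ}
    {x : U → V → ℕ} (hx : G.IsPerfectBMatching bU bV x) (yU : U → K) (yV : V → K) :
    G.totalWeight x - dualValue bU bV yU yV =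
      ∑ u, ∑ v, (x u v : K) * (G.weight u v - yU u - yV v) := by
  have h1 : ∑ u, (bU u : K) * yU u = ∑ u, ∑ v, (x u v : K) * yU u := by
    refine Finset.sum_congr rfl fun u _ => ?_
    rw [← hx.left u, ← Finset.sum_mul]
    push_cast; rfl
  have h2 : ∑ v, (bV v : K) * yV v = ∑ u, ∑ v, (x u v : K) * yV v := by
    rw [Finset.sum_comm]
    refine Finset.sum_congr rfl fun v _ => ?_
    rw [← hx.right v, ← Finset.sum_mul]
    push_cast; rfl
  simp only [totalWeight, dualValue, h1, h2, mul_sub, Finset.sum_sub_distrib]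
  ring

variable [LinearOrder K] [IsStrictOrderedRing K]

theorem WBipartite.mul_slack_nonneg {G : WBipartite K U V} {bU : U → ℤ} {bV : V → ℤ}
    {x : U → V → ℕ} (hx : G.IsPerfectBMatching bU bV x) {yU : U → K} {yV : V → K}
    (hy : G.IsDualFeasible yU yV) (u : U) (v : V) :
    0 ≤ (x u v : K) * (G.weight u v - yU u - yV v) := by
  by_cases h : G.edge u v
  · have := hy u v h
    exact mul_nonneg (Nat.cast_nonneg _) (by linarith)
  · simp [hx.supp u v h]

theorem WBipartite.dualValue_le_totalWeight {G : WBipartite K U V} {bU : U → ℤ} {bV : V → ℤ}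
    {x : U → V → ℕ} (hx : G.IsPerfectBMatching bU bV x) {yU : U → K} {yV : V → K}
    (hy : G.IsDualFeasible yU yV) : dualValue bU bV yU yV ≤ G.totalWeight x := by
  rw [← sub_nonneg, totalWeight_sub_dualValue hx]
  exact Finset.sum_nonneg fun u _ => Finset.sum_nonneg fun v _ => mul_slack_nonneg hx hy u v

/-- Complementary slackness for a pair without duality gap. -/
theorem WBipartite.mul_slack_eq_zero {G : WBipartite K U V} {bU : U → ℤ} {bV : V → ℤ}
    {x : U → V → ℕ} (hx : G.IsPerfectBMatching bU bV x) {yU : U → K} {yV : V → K}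
    (hy : G.IsDualFeasible yU yV) (h : G.totalWeight x ≤ dualValue bU bV yU yV) (u : U) (v : V) :
    (x u v : K) * (G.weight u v - yU u - yV v) = 0 := by
  have h0 : ∑ u, ∑ v, (x u v : K) * (G.weight u v - yU u - yV v) = 0 := by
    rw [← totalWeight_sub_dualValue hx, sub_eq_zero]
    exact le_antisymm h (dualValue_le_totalWeight hx hy)
  rw [Finset.sum_eq_zero_iff_of_nonneg fun u _ =>
    Finset.sum_nonneg fun v _ => mul_slack_nonneg hx hy u v] at h0
  have h1 := h0 u (Finset.mem_univ u)
  rw [Finset.sum_eq_zero_iff_of_nonneg fun v _ => mul_slack_nonneg hx hy u v] at h1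
  exact h1 v (Finset.mem_univ v)

end Matching

/-! ### Landing schedules as perfect `b`-matchings -/

section Schedule

variable {K A B : Type} [Field K] [Fintype A] [DecidableEq B] [Fintype B] {M : Market K A B}

/-- The flights' part of a perfect `b`-matching is a landing schedule. -/
theorem Market.exists_schedule_of_matching {x : Option A → B → ℕ}
    (hx : M.graph.IsPerfectBMatching M.leftReq M.rightReq x) :
    ∃ a : A → B, (∀ i s, x (some i) s = if a i = s then 1 else 0) ∧ M.IsLandingSchedule a ∧
      ∀ s, x none s + (Finset.univ.filter fun i => a i = s).card = M.cap s := by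
  have h1 : ∀ i, ∃ s₀, ∀ s, x (some i) s = if s₀ = s then 1 else 0 := by
    intro i
    have hsum : ∑ s, x (some i) s = 1 := by
      have := hx.left (some i)
      simp only [Market.leftReq] at this
      exact_mod_cast this
    -- Natural numbers with sum `1` consist of a single `1` and zeros.
    obtain ⟨s₀, hs₀⟩ : ∃ s₀, x (some i) s₀ ≠ 0 := by
      by_contra! h
      simp [h] at hsum
    rw [← Finset.add_sum_erase _ _ (Finset.mem_univ s₀)] at hsum
    refine ⟨s₀, fun s => ?_⟩
    by_cases hs : s₀ = s
    · rw [← hs, if_pos rfl]; omega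
    · have h2 : ∑ s ∈ Finset.univ.erase s₀, x (some i) s = 0 := by omega
      rw [if_neg hs]
      exact Finset.sum_eq_zero_iff.1 h2 s (by simp [Ne.symm hs])
  choose a ha using h1
  have hcap : ∀ s, x none s + (Finset.univ.filter fun i => a i = s).card = M.cap s := by
    intro s
    have h2 := hx.right s
    rw [Fintype.sum_option] at h2
    simp only [ha, Market.rightReq] at h2
    rw [Finset.card_filter]
    exact_mod_cast h2
  refine ⟨a, ha, ⟨fun i => ?_, fun s => by have := hcap s; omega⟩, hcap⟩
  by_contra h
  have h2 := hx.supp (some i) (a i) h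
  simp [ha] at h2

/-- The perfect `b`-matching that belongs to a landing schedule. -/
def Market.matching (M : Market K A B) (a : A → B) : Option A → B → ℕ
  | none, s => M.cap s - (Finset.univ.filter fun i => a i = s).card
  | some i, s => if a i = s then 1 else 0

theorem Market.matching_isPerfect {a : A → B} (ha : M.IsLandingSchedule a) :
    M.graph.IsPerfectBMatching M.leftReq M.rightReq (M.matching a) := by
  -- The truncated subtraction is exact because the schedule respects the capacities.
  have hcast : ∀ s, ((M.cap s - (Finset.univ.filter fun i => a i = s).card : ℕ) : ℤ) =
      M.cap s - (Finset.univ.filter fun i => a i = s).card := fun s => Nat.cast_sub (ha.2 s)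
  refine ⟨?_, ?_, fun s => ?_⟩
  · rintro (_ | i) s h
    · exact absurd trivial h
    · have : a i ≠ s := by
        rintro rfl
        exact h (ha.1 i)
      simp [Market.matching, this]
  · rintro (_ | i)
    · simp only [Market.matching, Market.leftReq, hcast, Finset.sum_sub_distrib]
      have h1 := Finset.card_eq_sum_card_fiberwise (f := a) (s := Finset.univ)
        (t := Finset.univ) (by simp)
      rw [Finset.card_univ] at h1
      rw [h1]
      push_cast; rfl
    · simp [Market.matching, Market.leftReq]
  · rw [Fintype.sum_option]
    simp only [Market.matching, Market.rightReq, hcast]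
    rw [Finset.card_filter]
    push_cast
    ring

theorem Market.exists_matching_iff_exists_schedule :
    (∃ x, M.graph.IsPerfectBMatching M.leftReq M.rightReq x) ↔ ∃ a, M.IsLandingSchedule a := by
  constructor
  · rintro ⟨x, hx⟩
    obtain ⟨a, _, ha, _⟩ := Market.exists_schedule_of_matching hx
    exact ⟨a, ha⟩
  · rintro ⟨a, ha⟩
    exact ⟨_, Market.matching_isPerfect ha⟩

end Schedule

/-! ### Equilibria and optimal primal-dual pairs -/

section Equilibrium

variable {K A B : Type} [Field K] [LinearOrder K] [Fintype A] [DecidableEq B]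

/-- The correct output of the program serves as the existence proof: a feasible market excludes the
negative answer. -/
theorem Market.exists_equilibrium_of_fin [IsStrictOrderedRing K] {n m : ℕ}
    (M : Market K (Fin n) (Fin m)) (h : ∃ a, M.IsLandingSchedule a) :
    ∃ a p, M.IsEquilibrium a p := by
  obtain ⟨_, τ, _, _, ⟨_, a, _, ha⟩ | ⟨_, h'⟩⟩ := marketProg_correct M
  · exact ⟨a, _, ha⟩
  · exact absurd h h'

/-- Renaming flights and slots. -/
def Market.reindex {A' B' : Type} (M : Market K A B) (eA : A ≃ A') (eB : B ≃ B') :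
    Market K A' B' where
  crit i := M.crit (eA.symm i)
  window i := (M.window (eA.symm i)).map eB.toEmbedding
  delay i s := M.delay (eA.symm i) (eB.symm s)
  cap s := M.cap (eB.symm s)

theorem card_filter_equiv {A' : Type} [Fintype A'] (e : A ≃ A') (P : A → Prop) (Q : A' → Prop)
    [DecidablePred P] [DecidablePred Q] (h : ∀ i, P i ↔ Q (e i)) :
    (Finset.univ.filter P).card = (Finset.univ.filter Q).card :=
  Finset.card_equiv e fun i => by simp [h]

theorem Market.exists_equilibrium [IsStrictOrderedRing K] [Fintype B] (M : Market K A B)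
    (h : ∃ a, M.IsLandingSchedule a) : ∃ a p, M.IsEquilibrium a p := by
  let eA := Fintype.equivFin A
  let eB := Fintype.equivFin B
  obtain ⟨b, hb1, hb2⟩ := h
  obtain ⟨a, p, ha⟩ := (M.reindex eA eB).exists_equilibrium_of_fin
    ⟨fun i => eB (b (eA.symm i)), fun i => by simpa [Market.reindex] using hb1 _, fun s => by
      refine le_trans (le_of_eq ?_) (hb2 (eB.symm s))
      refine card_filter_equiv eA.symm _ _ fun i => ?_
      rw [Equiv.eq_symm_apply]⟩
  have hcard : ∀ s, (Finset.univ.filter fun i => eB.symm (a (eA i)) = s).card =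
      (Finset.univ.filter fun i => a i = eB s).card := fun s =>
    card_filter_equiv eA _ _ fun i => by rw [Equiv.symm_apply_eq]
  refine ⟨fun i => eB.symm (a (eA i)), fun s => p (eB s), ⟨fun i => ?_, fun s => ?_⟩,
    fun s => ha.price_nonneg _, fun i s hs => ?_, fun s hs => ?_⟩
  · have := ha.schedule.1 (eA i)
    simp only [Market.reindex, Finset.mem_map_equiv, Equiv.symm_apply_apply] at this
    exact this
  · have := ha.schedule.2 (eB s)
    rw [hcard s]
    simpa [Market.reindex] using this
  · have := ha.min_cost (eA i) (eB s) (by simpa [Market.reindex] using hs)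
    simpa [Market.totalCost, Market.reindex] using this
  · rw [hcard s] at hs
    exact ha.unfilled_free (eB s) (by simpa [Market.reindex] using hs)

variable {M : Market K A B}

/-- Prices and costs of an equilibrium are feasible vertex duals. -/
theorem Market.IsEquilibrium.isDualFeasible [IsStrictOrderedRing K] {a : A → B} {p : B → K}
    (h : M.IsEquilibrium a p) : M.graph.IsDualFeasible
      (fun u => u.elim 1 fun i => M.totalCost p i (a i)) fun s => - p s := by
  rintro (_ | i) s he
  · have := h.price_nonneg s
    simp only [Market.graph, Option.elim]
    linarith
  · have := h.min_cost i s he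
    simp only [Market.graph, Option.elim]
    simp only [Market.totalCost] at this ⊢
    linarith

variable [Fintype B]

/-- Every edge of the matching has slack zero: a dummy edge is used only at an unfilled slot, whose
price is `0`, and the dual of a flight is by definition its cost in its own slot. -/
theorem Market.IsEquilibrium.totalWeight_eq {a : A → B} {p : B → K}
    (h : M.IsEquilibrium a p) : M.graph.totalWeight (M.matching a) =
      WBipartite.dualValue M.leftReq M.rightReq
        (fun u => u.elim 1 fun i => M.totalCost p i (a i)) fun s => - p s := by
  rw [← sub_eq_zero, WBipartite.totalWeight_sub_dualValue (Market.matching_isPerfect h.schedule)]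
  refine Finset.sum_eq_zero fun u _ => Finset.sum_eq_zero fun s _ => ?_
  rcases u with _ | i
  · simp only [Market.matching, Market.graph, Option.elim]
    by_cases hs : (Finset.univ.filter fun i => a i = s).card < M.cap s
    · rw [h.unfilled_free s hs]; ring
    · rw [Nat.sub_eq_zero_of_le (not_lt.1 hs)]; simp
  · simp only [Market.matching, Market.graph, Option.elim, Market.totalCost]
    split_ifs with hs
    · rw [hs]; ring
    · simp

variable [IsStrictOrderedRing K]

/-- A perfect matching and feasible duals without duality gap. -/
theorem Market.exists_tight_pair (h : ∃ a, M.IsLandingSchedule a) :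
    ∃ x yU yV, M.graph.IsPerfectBMatching M.leftReq M.rightReq x ∧
      M.graph.IsDualFeasible yU yV ∧
      M.graph.totalWeight x = WBipartite.dualValue M.leftReq M.rightReq yU yV := by
  obtain ⟨a, p, hap⟩ := M.exists_equilibrium h
  exact ⟨_, _, _, Market.matching_isPerfect hap.schedule, hap.isDualFeasible,
    hap.totalWeight_eq⟩

theorem Market.exists_optimal_pair (h : ∃ a, M.IsLandingSchedule a) :
    (∃ x, M.graph.IsMinPerfectBMatching M.leftReq M.rightReq x) ∧
      ∃ yU yV, M.graph.IsOptimalDual M.leftReq M.rightReq yU yV := by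
  obtain ⟨x, yU, yV, hx, hy, heq⟩ := M.exists_tight_pair h
  refine ⟨⟨x, hx, fun x' hx' => ?_⟩, yU, yV, hy, fun zU zV hz => ?_⟩
  · rw [heq]
    exact WBipartite.dualValue_le_totalWeight hx' hy
  · rw [← heq]
    exact WBipartite.dualValue_le_totalWeight hx hz

theorem Market.isEquilibrium_of_optimal_pair {x : Option A → B → ℕ} {yU : Option A → K}
    {yV : B → K} (hx : M.graph.IsMinPerfectBMatching M.leftReq M.rightReq x)
    (hy : M.graph.IsOptimalDual M.leftReq M.rightReq yU yV) :
    ∃ a : A → B, (∀ i s, x (some i) s = if a i = s then 1 else 0) ∧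
      M.IsEquilibrium a (fun s => 1 - yU none - yV s) ∧
      ∀ i, M.totalCost (fun s => 1 - yU none - yV s) i (a i) = yU (some i) + 1 - yU none := by
  obtain ⟨a, hxa, ha, hcap⟩ := Market.exists_schedule_of_matching hx.1
  obtain ⟨x₀, zU, zV, hx₀, hz, heq⟩ := M.exists_tight_pair ⟨a, ha⟩
  -- The gap-free pair squeezes the given one: `x` weighs no more than `x₀`, whose weight is the
  -- dual value of `z`, which is at most that of `y`.
  have hslack := WBipartite.mul_slack_eq_zero hx.1 hy.1
    ((hx.2 x₀ hx₀).trans (heq.le.trans (hy.2 zU zV hz)))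
  have hcost : ∀ i, M.totalCost (fun s => 1 - yU none - yV s) i (a i) =
      yU (some i) + 1 - yU none := by
    intro i
    have h1 := hslack (some i) (a i)
    rw [hxa, if_pos rfl, Nat.cast_one, one_mul] at h1
    simp only [Market.graph] at h1
    simp only [Market.totalCost]
    linear_combination h1
  refine ⟨a, hxa, ⟨ha, fun s => ?_, fun i s hs => ?_, fun s hs => ?_⟩, hcost⟩
  · have h1 : yU none + yV s ≤ 1 := hy.1 none s trivial
    linarith
  · rw [hcost i]
    have h1 : yU (some i) + yV s ≤ M.crit i * M.delay i s := hy.1 (some i) s hs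
    simp only [Market.totalCost]
    linarith
  · have h1 := hslack none s
    -- The dummy edge carries the spare capacity of `s`, which is positive here, so complementary
    -- slackness makes it tight.
    have h2 : (x none s : K) ≠ 0 := by
      have := hcap s
      exact Nat.cast_ne_zero.2 (by omega)
    simpa [Market.graph, h2] using h1

end Equilibrium

end ATFM

theorem theorem1 :
    -- a program of the combinatorial machine that is a strongly polynomial algorithm
    (∃ P : Prog, IsStronglyPolynomialMarketAlgorithm P) ∧
    -- the reduction to minimum-weight perfect b-matching
    (∀ (K A B : Type) [Field K] [LinearOrder K] [IsStrictOrderedRing K] [Fintype A] [Fintype B]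
        [DecidableEq B] (M : Market K A B),
      -- a perfect b-matching exists exactly if a landing schedule exists
      ((∃ x, M.graph.IsPerfectBMatching M.leftReq M.rightReq x) ↔
        ∃ a, M.IsLandingSchedule a) ∧
      -- and then there are a minimum-weight one and optimal vertex duals
      ((∃ a, M.IsLandingSchedule a) →
        (∃ x, M.graph.IsMinPerfectBMatching M.leftReq M.rightReq x) ∧
        ∃ yU yV, M.graph.IsOptimalDual M.leftReq M.rightReq yU yV) ∧
      -- every such pair gives an equilibrium and the total costs of the flights
      ∀ x yU yV, M.graph.IsMinPerfectBMatching M.leftReq M.rightReq x →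
        M.graph.IsOptimalDual M.leftReq M.rightReq yU yV →
        ∃ a : A → B, (∀ i s, x (some i) s = if a i = s then 1 else 0) ∧
          M.IsEquilibrium a (fun s => 1 - yU none - yV s) ∧
          ∀ i, M.totalCost (fun s => 1 - yU none - yV s) i (a i) = yU (some i) + 1 - yU none) := by
  exact ⟨⟨marketProg, marketProg_isStronglyPolynomial⟩, fun K A B _ _ _ _ _ _ M =>
    ⟨Market.exists_matching_iff_exists_schedule, Market.exists_optimal_pair,
      fun _ _ _ hx hy => Market.isEquilibrium_of_optimal_pair hx hy⟩⟩
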